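/- Write $x^\perp=(-x_2,x_1)$ for $x\in\mathbb R^2$, let $B_r(p)$ be the open disc of radius $r$ about $p$, and let $\operatorname{supp} f$ be the complement of the largest open set on which $f=0$ almost everywhere. Fix $T^*\in(0,\infty]$ and $\varepsilon_1>0$. For each $\varepsilon\in(0,\varepsilon_1)$ let $F_{1,\varepsilon},F_{2,\varepsilon}:\mathbb R^2\times[0,T^*)\to\mathbb R^2$ be Borel measurable, let $\omega_\varepsilon(\cdot,t)\in L^1\cap L^\infty(\mathbb R^2)$ for every $t\in[0,T^*)$, set $\omega_{0,\varepsilon}=\omega_\varepsilon(\cdot,0)$ and $$u_\varepsilon(x,t)=\frac1{2\pi}\int_{\mathbb R^2}\frac{(x-y)^\perp}{|x-y|^2}\,\omega_\varepsilon(y,t)\,dy,\qquad V_\varepsilon=u_\varepsilon+F_{1,\varepsilon}+F_{2,\varepsilon}.$$ Assume that $\omega_\varepsilon$ solves $\partial_t\omega_\varepsilon+V_\varepsilon\cdot\nabla\omega_\varepsilon=0$ weakly, i.e. for all $\phi\in C_c^\infty(\mathbb R^2\times\mathbb R)$ and $t\in[0,T^*)$ (right derivative at $t=0$) $$\frac{d}{dt}\int\omega_\varepsilon(x,t)\phi(x,t)\,dx=\int\omega_\varepsilon(x,t)\bigl(\partial_t\phi+V_\varepsilon\cdot\nabla\phi\bigr)(x,t)\,dx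 ,$$ and that there are trajectories $X_\varepsilon(\alpha,t)$, $\alpha\in\mathbb R^2$, $t\in[0,T^*)$, with $X_\varepsilon(\alpha,0)=\alpha$ and $\frac{d}{dt}X_\varepsilon(\alpha,t)=V_\varepsilon(X_\varepsilon(\alpha,t),t)$, such that for every $t$ the map $X_\varepsilon(\cdot,t)$ preserves Lebesgue measure and $\omega_\varepsilon(X_\varepsilon(\alpha,t),t)=\omega_{0,\varepsilon}(\alpha)$ for almost every $\alpha$. Let $A_\varepsilon$ ($\varepsilon\in(0,\varepsilon_1)$) be real numbers with $A_\varepsilon\to0$ as $\varepsilon\to0^+$, and suppose that there are $L\ge0$, $C>0$, $\gamma>0$, $p_1\in(2,\infty]$, $p_0\in\mathbb R^2$ and $\Omega\ne0$, all independent of $\varepsilon$ and $t$, such that for all $\varepsilon\in(0,\varepsilon_1)$: 1. $|F_{1,\varepsilon}(x,t)-F_{1,\varepsilon}(y,t)|\le L|x-y|$ for all $x,y\in\mathbb R^2$, $t\in[0,T^*)$; 2. $\varepsilon\le CA_\varepsilon$ and $\|F_{2,\varepsilon}(\cdot,t)\|_{L^\infty}\le CA_\varepsilon$ for all $t\in[0,T^*)$;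 3. $\omega_{0,\varepsilon}\ge0$ a.e. or $\omega_{0,\varepsilon}\le0$ a.e., and $\operatorname{supp}\omega_{0,\varepsilon}\subset B_\varepsilon(p_0)$; 4. $\|\omega_{0,\varepsilon}\|_{L^{p_1}}\le A_\varepsilon^{-\gamma}$; and $\Omega_\varepsilon:=\int\omega_{0,\varepsilon}\,dx\to\Omega$ as $\varepsilon\to0^+$. Let $p_\varepsilon(t)=\frac1{\Omega_\varepsilon}\int x\,\omega_\varepsilon(x,t)\,dx$ be the center of vorticity. Then for every real $T<T^*$ and every $a<\frac12$ there is $\varepsilon_0\in(0,\varepsilon_1)$ such that for all $0<\varepsilon\le\varepsilon_0$ and all $t\in[0,T]$ $$\operatorname{supp}\,\omega_\varepsilon(\cdot,t)\subset B_{A_\varepsilon^{a}}(p_\varepsilon(t)).$$ -/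

import Mathlib

open MeasureTheory Filter Topology
open scoped ENNReal NNReal

noncomputable section

/-- The plane with its Euclidean norm. -/
abbrev Plane : Type := EuclideanSpace ℝ (Fin 2)

/-- Rotation by a quarter turn: `(x₁, x₂)^⊥ = (-x₂, x₁)`. -/
def perp (x : Plane) : Plane := !₂[-(x 1), x 0]

/-- The velocity field generated by a vorticity `f` through the Biot–Savart law,
`x ↦ (1 / 2π) ∫ (x - y)^⊥ / |x - y|² f(y) dy`. -/
def biotSavart (f : Plane → ℝ) (x : Plane) : Plane :=
  (1 / (2 * Real.pi)) • ∫ y, (f y / ‖x - y‖ ^ 2) • perp (x - y)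

/-- The support of a function that is only relevant up to null sets: the complement of the
largest open set on which it vanishes almost everywhere. -/
def essSupport (f : Plane → ℝ) : Set Plane :=
  {x | ∀ U ∈ 𝓝 x, ¬ (∀ᵐ y ∂(volume.restrict U), f y = 0)}

/-- The time interval `[0, T*)`, where `T*` may be `∞`. -/
def lifespan (Tstar : EReal) : Set ℝ := {t | 0 ≤ t ∧ (t : EReal) < Tstar}

/-- The full velocity `u + F₁ + F₂`, with `u` generated by the vorticity itself. -/
def totalVelocity (ω : ℝ → Plane → ℝ) (F₁ F₂ : ℝ → Plane → Plane) (t : ℝ) (x : Plane) : Plane :=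
  biotSavart (ω t) x + F₁ t x + F₂ t x

/-- `∂ₜ ω + V · ∇ω = 0` on `[0, T*)` in the weak sense: for all smooth compactly supported test
functions `φ`, one has `d/dt ∫ ω φ dx = ∫ ω (∂ₜ φ + V · ∇φ) dx`. The test functions are defined
on `ℝ × ℝ²`; they need not vanish at the initial time. -/
def IsWeakTransport (Tstar : EReal) (ω : ℝ → Plane → ℝ) (V : ℝ → Plane → Plane) : Prop :=
  ∀ φ : ℝ → Plane → ℝ,
    ContDiff ℝ ((⊤ : ℕ∞) : WithTop ℕ∞) (fun z : ℝ × Plane => φ z.1 z.2) →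
    HasCompactSupport (fun z : ℝ × Plane => φ z.1 z.2) →
    ∀ t ∈ lifespan Tstar,
      HasDerivWithinAt (fun s => ∫ x, ω s x * φ s x)
        (∫ x, ω t x * (deriv (fun s => φ s x) t + fderiv ℝ (φ t) x (V t x)))
        (lifespan Tstar) t

/-- `X t α` is the position at time `t` of the particle that starts at `α` and moves with the
velocity `V`. -/
def IsTrajectoryMap (Tstar : EReal) (V : ℝ → Plane → Plane) (X : ℝ → Plane → Plane) : Prop :=
  ∀ α : Plane, X 0 α = α ∧
    ∀ t ∈ lifespan Tstar, HasDerivWithinAt (fun s => X s α) (V t (X t α)) (lifespan Tstar) t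

/-- A vorticity `ω t ∈ L¹ ∩ L^∞` moving with the velocity `u + F₁ + F₂`, where `u` is its own
Biot–Savart velocity: it solves the transport equation weakly, is carried by the particle
trajectories `X`, and the maps `X t` preserve Lebesgue measure. -/
structure IsTransportedVortex (Tstar : EReal) (ω : ℝ → Plane → ℝ) (F₁ F₂ : ℝ → Plane → Plane)
    (X : ℝ → Plane → Plane) : Prop where
  memLp_one : ∀ t ∈ lifespan Tstar, MemLp (ω t) 1 volume
  memLp_top : ∀ t ∈ lifespan Tstar, MemLp (ω t) ∞ volume
  weak : IsWeakTransport Tstar ω (totalVelocity ω F₁ F₂)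
  trajectory : IsTrajectoryMap Tstar (totalVelocity ω F₁ F₂) X
  transport : ∀ t ∈ lifespan Tstar, ∀ᵐ α ∂(volume : Measure Plane), ω t (X t α) = ω 0 α
  measurePreserving : ∀ t ∈ lifespan Tstar, MeasurePreserving (X t) volume volume

/-- The total vorticity `Ω = ∫ ω(x, 0) dx`. -/
def totalVorticity (ω : ℝ → Plane → ℝ) : ℝ := ∫ x, ω 0 x

/-- The center of vorticity `p(t) = (1 / Ω) ∫ x ω(x, t) dx`. -/
def vorticityCenter (ω : ℝ → Plane → ℝ) (t : ℝ) : Plane :=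
  (totalVorticity ω)⁻¹ • ∫ x, ω t x • x

end

/-!
The vorticity is followed along the particle trajectories. The label of a particle is its initial
position, and the normalised absolute value of the initial vorticity is a probability measure `μ`
on labels (`labelMeasure`). Since the flow preserves Lebesgue measure and transports the vorticity,
the Biot–Savart velocity is, up to the constant `Ω_ε / 2π`, the average of the odd kernel
`kern z = z^⊥ / |z|²` over `μ`, and the center of vorticity is the average position. The structure
`VortexFlow` records this description.

Let `Z` be the position of a particle relative to the center. The field `F₁` may be unbounded in
time, but its Lipschitz bound controls relative positions, so that `Z` is bounded and Lipschitz in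
time for almost every particle (`VortexFlow.exists_rel_bound`). The field `F₂` is bounded only
almost everywhere; by Fubini, almost every particle sees this bound at almost every time, which is
enough because trajectories are differentiable everywhere (`sub_le_of_ae_deriv_le`).

Confinement rests on the even moments `J n = ∫ |Z| ^ (2 n) dμ`. The mutual interaction conserves
`J 1`, so Grönwall's inequality gives `J 1 = O(A²)` (`VortexFlow.moment_one_le`). In the evolution
of `J (i + 2)` the radial effect `⟪z, kern (z - w)⟫ = -⟪z, w^⊥⟫ / |z - w|²` of a particle at `w` on
one at `z` is symmetrised over pairs of particles, after subtraction of its leading term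
`-⟪z, w^⊥⟫ / |z|²` for `|w| ≪ |z|`; this term is linear in `w` and contributes nothing, because the mean of `Z` is zero.
What remains is bounded by `J 1 * J i` (`abs_moment_interaction_le`,
`VortexFlow.abs_integral_inner_interaction_le`), and induction gives `J (2 k) = O(A ^ (2 k))` for
all `k` (`VortexFlow.exists_moment_bound`). Hence for `a < 1/2` the mass at distance more than a
multiple of `A ^ a` from the center is smaller than any power of `A`.

Finally, consider a particle at distance at least `r ∼ A ^ a`. The interaction changes `|Z|²` at a
rate of at most `J 1 / r² ∼ A ^ (2 - 2 a)`, up to the effect of the distant mass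
(`VortexFlow.abs_inner_interaction_le`). The latter is negligible: by Hölder's inequality with
`p₁ > 2`, the vorticity in a disc of radius `ρ` generates a velocity bounded by a power of `ρ`
times a negative power of `A` (`exists_lintegral_near_le`), and `ρ` can be taken a high power of
`A`. Since `2 - 2 a > 2 a`, the particle cannot leave the disc of radius `A ^ a / 2` in bounded
time (`VortexFlow.eventually_ae_norm_rel_le`).
-/

open Set
open scoped RealInnerProductSpace

/-! ### Differential inequalities that hold almost everywhere in time -/

/-- The derivative exists everywhere, but is bounded only almost everywhere; no integrability of
the derivative is needed. -/
lemma sub_le_of_ae_deriv_le {f f' : ℝ → ℝ} {a b c : ℝ} (hab : a ≤ b)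
    (hf : ContinuousOn f (Icc a b)) (hd : ∀ t ∈ Ioo a b, HasDerivAt f (f' t) t)
    (hle : ∀ᵐ t ∂(volume.restrict (Ioo a b)), f' t ≤ c) : f b - f a ≤ c * (b - a) := by
  -- `max c (f' t)` dominates the derivative everywhere and agrees with `c` almost everywhere.
  have hae : (fun t => max c (f' t)) =ᵐ[volume.restrict (Icc a b)] fun _ => c := by
    rw [← restrict_Ioo_eq_restrict_Icc]
    filter_upwards [hle] with t ht using max_eq_left ht
  have hint : IntegrableOn (fun t => max c (f' t)) (Icc a b) volume :=
    (integrable_congr hae).2 (integrableOn_const (by simp))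
  have h := intervalIntegral.sub_le_integral_of_hasDeriv_right_of_le hab hf
    (fun t ht => (hd t ht).hasDerivWithinAt) hint (fun t _ => le_max_right _ _)
  refine h.trans (le_of_eq ?_)
  rw [intervalIntegral.integral_of_le hab, ← integral_Icc_eq_integral_Ioc, integral_congr_ae hae]
  simp [hab, mul_comm]

lemma norm_sub_le_of_ae_norm_deriv_le {f f' : ℝ → Plane} {a b c : ℝ} (hab : a ≤ b)
    (hf : ContinuousOn f (Icc a b)) (hd : ∀ t ∈ Ioo a b, HasDerivAt f (f' t) t)
    (hle : ∀ᵐ t ∂(volume.restrict (Ioo a b)), ‖f' t‖ ≤ c) : ‖f b - f a‖ ≤ c * (b - a) := by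
  rcases eq_or_ne (f b - f a) 0 with h0 | h0
  · have h1 := sub_le_of_ae_deriv_le (f := fun _ => (0 : ℝ)) (f' := fun _ => 0) (c := c) hab
      continuousOn_const (fun t _ => hasDerivAt_const _ _)
      (hle.mono fun t ht => (norm_nonneg _).trans ht)
    simpa [h0] using h1
  · have h1 := sub_le_of_ae_deriv_le (f := fun t => ⟪f b - f a, f t⟫)
      (f' := fun t => ⟪f b - f a, f' t⟫) (c := ‖f b - f a‖ * c) hab
      (continuousOn_const.inner hf)
      (fun t ht => by simpa using (hasDerivAt_const t (f b - f a)).inner ℝ (hd t ht))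
      (hle.mono fun t ht => (real_inner_le_norm _ _).trans
        (mul_le_mul_of_nonneg_left ht (norm_nonneg _)))
    rw [← inner_sub_right, real_inner_self_eq_norm_sq, sq, mul_assoc] at h1
    exact le_of_mul_le_mul_left h1 (norm_pos_iff.2 h0)

lemma gronwall_of_ae {f f' : ℝ → ℝ} {a b K c : ℝ} (hab : a ≤ b) (hK : 0 ≤ K) (hc : 0 ≤ c)
    (hf : ContinuousOn f (Icc a b)) (hd : ∀ t ∈ Ioo a b, HasDerivAt f (f' t) t)
    (hle : ∀ᵐ t ∂(volume.restrict (Ioo a b)), f' t ≤ K * f t + c) :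
    f b ≤ Real.exp (K * (b - a)) * (f a + c * (b - a)) := by
  have h := sub_le_of_ae_deriv_le (f := fun t => Real.exp (-(K * (t - a))) * f t)
    (f' := fun t => Real.exp (-(K * (t - a))) * -K * f t + Real.exp (-(K * (t - a))) * f' t)
    (c := c) hab (by fun_prop)
    (fun t ht => by
      refine HasDerivAt.mul (HasDerivAt.exp ?_) (hd t ht)
      simpa using! (((hasDerivAt_id t).sub_const a).const_mul K).neg)
    (by
      filter_upwards [hle, ae_restrict_mem measurableSet_Ioo] with t ht hta
      have he : Real.exp (-(K * (t - a))) ≤ 1 :=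
        Real.exp_le_one_iff.2 (neg_nonpos.2 (mul_nonneg hK (sub_nonneg.2 hta.1.le)))
      have hp := Real.exp_pos (-(K * (t - a)))
      calc _ = Real.exp (-(K * (t - a))) * (f' t - K * f t) := by ring
        _ ≤ Real.exp (-(K * (t - a))) * c := by gcongr; linarith
        _ ≤ c := mul_le_of_le_one_left hc he)
  simp only [sub_self, mul_zero, neg_zero, Real.exp_zero, one_mul] at h
  have hp := Real.exp_pos (K * (b - a))
  calc f b = Real.exp (K * (b - a)) * (Real.exp (-(K * (b - a))) * f b) := by
        rw [← mul_assoc, ← Real.exp_add]; simp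
    _ ≤ _ := by gcongr; linarith

/-- The differential inequality is only needed above the threshold `θ`: apply the previous bound
from the last time at which `f ≤ θ`. -/
lemma gronwall_of_ae_of_threshold {f f' : ℝ → ℝ} {T K c θ : ℝ} (hK : 0 ≤ K) (hc : 0 ≤ c)
    (hθ : 0 ≤ θ) (hf : ContinuousOn f (Icc 0 T)) (hd : ∀ t ∈ Ioo 0 T, HasDerivAt f (f' t) t)
    (hle : ∀ᵐ t ∂(volume.restrict (Ioo 0 T)), θ ≤ f t → f' t ≤ K * f t + c) (h0 : f 0 ≤ θ)
    {t : ℝ} (ht : t ∈ Icc 0 T) : f t ≤ Real.exp (K * T) * (θ + c * T) := by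
  set S : Set ℝ := {s ∈ Icc 0 t | f s ≤ θ} with hS
  have hft : ContinuousOn f (Icc 0 t) := hf.mono (Icc_subset_Icc_right ht.2)
  have hSc : IsCompact S := by
    have : IsClosed S := hft.preimage_isClosed_of_isClosed isClosed_Icc isClosed_Iic
    exact isCompact_Icc.of_isClosed_subset this (sep_subset _ _)
  have hSne : S.Nonempty := ⟨0, ⟨le_rfl, ht.1⟩, h0⟩
  obtain ⟨⟨ha0, hat⟩, hfa⟩ := hSc.sSup_mem hSne
  set a := sSup S
  have hgt : ∀ s ∈ Ioo a t, θ ≤ f s := by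
    intro s hs
    by_contra! hlt
    exact absurd (le_csSup hSc.bddAbove ⟨⟨ha0.trans hs.1.le, hs.2.le⟩, hlt.le⟩) (not_le.2 hs.1)
  have hsub : Ioo a t ⊆ Ioo 0 T := Ioo_subset_Ioo ha0 ht.2
  have h := gronwall_of_ae hat hK hc (hft.mono (Icc_subset_Icc_left ha0))
    (fun s hs => hd s (hsub hs)) (by
      filter_upwards [ae_mono (Measure.restrict_mono hsub le_rfl) hle,
        ae_restrict_mem measurableSet_Ioo] with s hs hsm using hs (hgt s hsm))
  have hta : t - a ≤ T := by linarith [ht.2]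
  have hta0 : 0 ≤ t - a := sub_nonneg.2 hat
  calc f t ≤ _ := h
    _ ≤ Real.exp (K * (t - a)) * (θ + c * T) := by gcongr
    _ ≤ _ := by
      have : 0 ≤ c * T := mul_nonneg hc (ht.1.trans ht.2)
      gcongr

/-! ### The Biot–Savart kernel -/

/-- The kernel `z^⊥ / |z|²`, without the factor `1 / 2π`; it takes the value `0` at the origin. -/
noncomputable def kern (z : Plane) : Plane := (‖z‖ ^ 2)⁻¹ • perp z

lemma norm_perp (z : Plane) : ‖perp z‖ = ‖z‖ := by
  simp [perp, EuclideanSpace.norm_eq, Fin.sum_univ_two, add_comm]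

lemma perp_sub (z w : Plane) : perp (z - w) = perp z - perp w := by
  ext i; fin_cases i <;> simp [perp]; ring

lemma continuous_perp : Continuous perp := by
  unfold perp
  fun_prop

lemma inner_perp_self (z : Plane) : ⟪z, perp z⟫ = 0 := by
  simp [perp, PiLp.inner_apply, Fin.sum_univ_two]; ring

lemma inner_perp_comm (z w : Plane) : ⟪w, perp z⟫ = -⟪z, perp w⟫ := by
  simp [perp, PiLp.inner_apply, Fin.sum_univ_two]; ring

/-- The quarter turn as a continuous linear map. -/
noncomputable def perpL : Plane →L[ℝ] Plane :=
  LinearMap.toContinuousLinearMap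
    { toFun := perp
      map_add' := fun z w => by ext i; fin_cases i <;> simp [perp]; ring
      map_smul' := fun c z => by ext i; fin_cases i <;> simp [perp] }

lemma perpL_apply (z : Plane) : perpL z = perp z := rfl

lemma norm_kern (z : Plane) : ‖kern z‖ = ‖z‖⁻¹ := by
  rw [kern, norm_smul, norm_perp, norm_inv, norm_pow, norm_norm]
  rcases eq_or_ne ‖z‖ 0 with h | h
  · simp [h]
  · field_simp

lemma kern_sub_comm (z w : Plane) : kern (w - z) = -kern (z - w) := by
  rw [kern, kern, norm_sub_rev, perp_sub, perp_sub, ← smul_neg, neg_sub]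

lemma measurable_kern : Measurable kern :=
  ((continuous_norm.pow 2).measurable.inv).smul continuous_perp.measurable

lemma inner_kern_sub_left (z w : Plane) : ⟪z, kern (z - w)⟫ = -(⟪z, perp w⟫ / ‖z - w‖ ^ 2) := by
  rw [kern, inner_smul_right, perp_sub, inner_sub_right, inner_perp_self]; ring

lemma inner_kern_sub_right (z w : Plane) : ⟪w, kern (z - w)⟫ = -(⟪z, perp w⟫ / ‖z - w‖ ^ 2) := by
  rw [kern, inner_smul_right, perp_sub, inner_sub_right, inner_perp_self, inner_perp_comm]; ring

lemma abs_inner_perp_le (z w : Plane) : |⟪z, perp w⟫| ≤ ‖w‖ * ‖z - w‖ := by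
  have : ⟪z, perp w⟫ = ⟪z - w, perp w⟫ := by rw [inner_sub_left, inner_perp_self, sub_zero]
  rw [this, mul_comm, ← norm_perp w]
  exact abs_real_inner_le_norm _ _

/-- The symmetrised interaction of two particles at `z` and `w` in the evolution of the moment of
order `2 i + 4`, for `‖w‖ ≤ ‖z‖`. -/
lemma abs_moment_interaction_le_of_le (i : ℕ) {z w : Plane} (hzw : ‖w‖ ≤ ‖z‖) :
    |((‖z‖ ^ 2) ^ (i + 1) - (‖w‖ ^ 2) ^ (i + 1)) * (⟪z, perp w⟫ / ‖z - w‖ ^ 2)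
        - ((‖z‖ ^ 2) ^ i - (‖w‖ ^ 2) ^ i) * ⟪z, perp w⟫|
      ≤ (6 * i + 2) * (‖z‖ ^ 2 * (‖w‖ ^ 2) ^ i + ‖w‖ ^ 2 * (‖z‖ ^ 2) ^ i) := by
  rcases eq_or_ne z w with rfl | hne
  · simp only [sub_self, zero_mul, abs_zero]; positivity
  have hn : 0 < ‖z - w‖ := norm_pos_iff.2 (sub_ne_zero.2 hne)
  have hD : ‖z - w‖ ^ 2 = ‖z‖ ^ 2 + ‖w‖ ^ 2 - 2 * ⟪z, w⟫ := by rw [norm_sub_sq_real]; ring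
  have hw := abs_inner_perp_le z w
  have hd : |⟪z, w⟫| ≤ ‖z‖ * ‖w‖ := abs_real_inner_le_norm _ _
  have hdiff : ‖z‖ - ‖w‖ ≤ ‖z - w‖ := norm_sub_norm_le z w
  set s := ‖z‖
  set r := ‖w‖
  set δ := ‖z - w‖
  set d := ⟪z, w⟫
  set p := ⟪z, perp w⟫
  have hr : 0 ≤ r := norm_nonneg _
  have hs : 0 ≤ s := norm_nonneg _
  -- clear the denominator, using `‖z - w‖² = s² + r² - 2⟪z, w⟫`
  have key : ((s ^ 2) ^ (i + 1) - (r ^ 2) ^ (i + 1)) * (p / δ ^ 2)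
        - ((s ^ 2) ^ i - (r ^ 2) ^ i) * p
      = p / δ ^ 2 * ((s ^ 2 * (r ^ 2) ^ i - r ^ 2 * (s ^ 2) ^ i)
          + 2 * d * ((s ^ 2) ^ i - (r ^ 2) ^ i)) := by
    field_simp
    rw [hD]; ring
  have hpow : ∀ n : ℕ, |(s ^ 2) ^ n - (r ^ 2) ^ n| * s ^ 2 ≤ 2 * n * δ * s * (s ^ 2) ^ n := by
    intro n
    rcases n with _ | n
    · simp
    have h1 := abs_pow_sub_pow_le (s ^ 2) (r ^ 2) (n + 1)
    have h2 : |s ^ 2 - r ^ 2| ≤ δ * (2 * s) := by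
      rw [abs_of_nonneg (by nlinarith), sq_sub_sq, mul_comm]
      gcongr; linarith
    rw [abs_of_nonneg (sq_nonneg s), abs_of_nonneg (sq_nonneg r),
      max_eq_left (by gcongr), Nat.add_sub_cancel] at h1
    calc _ ≤ |s ^ 2 - r ^ 2| * ↑(n + 1) * (s ^ 2) ^ n * s ^ 2 := by gcongr
      _ ≤ δ * (2 * s) * ↑(n + 1) * (s ^ 2) ^ n * s ^ 2 := by gcongr
      _ = _ := by ring
  have hps : p / δ ^ 2 = p / δ * δ⁻¹ := by field_simp
  have hpδ : |p / δ| ≤ r := by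
    rw [abs_div, abs_of_pos hn, div_le_iff₀ hn]; exact hw
  have hmain : |(s ^ 2 * (r ^ 2) ^ i - r ^ 2 * (s ^ 2) ^ i)
          + 2 * d * ((s ^ 2) ^ i - (r ^ 2) ^ i)| * r ≤
        (6 * i + 2) * (r ^ 2 * (s ^ 2) ^ i + s ^ 2 * (r ^ 2) ^ i) * δ := by
    rcases i with _ | i
    · simp only [pow_zero, mul_one, sub_self, mul_zero, add_zero, CharP.cast_eq_zero, zero_add]
      rw [abs_of_nonneg (by nlinarith), sq_sub_sq]
      calc (s + r) * (s - r) * r ≤ (s + s) * δ * s := by gcongr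
        _ ≤ _ := by nlinarith [mul_nonneg hn.le (sq_nonneg r)]
    · have ha : |s ^ 2 * (r ^ 2) ^ (i + 1) - r ^ 2 * (s ^ 2) ^ (i + 1)| * r
          ≤ 2 * i * δ * (r ^ 2 * (s ^ 2) ^ (i + 1)) := by
        have : s ^ 2 * (r ^ 2) ^ (i + 1) - r ^ 2 * (s ^ 2) ^ (i + 1)
          = -(r ^ 2 * (s ^ 2 * ((s ^ 2) ^ i - (r ^ 2) ^ i))) := by ring
        rw [this, abs_neg, abs_mul, abs_mul, abs_of_nonneg (sq_nonneg r),
          abs_of_nonneg (sq_nonneg s)]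
        calc _ = r ^ 2 * (|(s ^ 2) ^ i - (r ^ 2) ^ i| * s ^ 2) * r := by ring
          _ ≤ r ^ 2 * (2 * i * δ * s * (s ^ 2) ^ i) * s :=
            mul_le_mul (mul_le_mul_of_nonneg_left (hpow i) (sq_nonneg r)) hzw hr (by positivity)
          _ = _ := by ring
      have hb : |2 * d * ((s ^ 2) ^ (i + 1) - (r ^ 2) ^ (i + 1))| * r
          ≤ 4 * (i + 1) * δ * (r ^ 2 * (s ^ 2) ^ (i + 1)) := by
        rw [abs_mul, abs_mul, abs_two]
        have h1 := hpow (i + 1)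
        rcases hs.eq_or_lt with h0 | h0
        · have : r = 0 := le_antisymm (by rw [h0]; exact hzw) hr
          simp [this]
        · have h2 : |(s ^ 2) ^ (i + 1) - (r ^ 2) ^ (i + 1)| * s
              ≤ 2 * (i + 1) * δ * (s ^ 2) ^ (i + 1) := by
            refine le_of_mul_le_mul_right (?_ : _ * s ≤ _ * s) h0
            calc _ = _ := by rw [mul_assoc, ← sq]
              _ ≤ _ := h1
              _ = _ := by push_cast; ring
          calc _ ≤ 2 * (s * r) * |(s ^ 2) ^ (i + 1) - (r ^ 2) ^ (i + 1)| * r := by gcongr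
            _ = 2 * r ^ 2 * (|(s ^ 2) ^ (i + 1) - (r ^ 2) ^ (i + 1)| * s) := by ring
            _ ≤ 2 * r ^ 2 * (2 * (i + 1) * δ * (s ^ 2) ^ (i + 1)) := by gcongr
            _ = _ := by ring
      have hc := abs_add_le (s ^ 2 * (r ^ 2) ^ (i + 1) - r ^ 2 * (s ^ 2) ^ (i + 1))
        (2 * d * ((s ^ 2) ^ (i + 1) - (r ^ 2) ^ (i + 1)))
      have hi : (0 : ℝ) ≤ i := Nat.cast_nonneg i
      calc _ ≤ _ := mul_le_mul_of_nonneg_right hc hr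
        _ ≤ 2 * i * δ * (r ^ 2 * (s ^ 2) ^ (i + 1))
            + 4 * (i + 1) * δ * (r ^ 2 * (s ^ 2) ^ (i + 1)) := by rw [add_mul]; gcongr
        _ = (6 * i + 4) * (r ^ 2 * (s ^ 2) ^ (i + 1) + 0) * δ := by ring
        _ ≤ _ := by
          push_cast
          gcongr ?_ * (_ + ?_) * _
          · linarith
          · positivity
  rw [key, hps, abs_mul, abs_mul, abs_inv, abs_of_pos hn]
  calc _ ≤ r * δ⁻¹ * |(s ^ 2 * (r ^ 2) ^ i - r ^ 2 * (s ^ 2) ^ i)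
          + 2 * d * ((s ^ 2) ^ i - (r ^ 2) ^ i)| := by gcongr
    _ ≤ δ⁻¹ * ((6 * i + 2) * (r ^ 2 * (s ^ 2) ^ i + s ^ 2 * (r ^ 2) ^ i) * δ) := by
      rw [mul_comm r, mul_assoc, mul_comm r]; gcongr
    _ = _ := by field_simp; ring

/-- The symmetrised interaction of two particles at `z` and `w` in the evolution of the moment of
order `2 i + 4`. The subtracted term has a vanishing double integral when the center of mass is
the origin; with it the interaction gains a factor `|w|²` where `|w|` is much smaller
than `|z|`. -/
lemma abs_moment_interaction_le (i : ℕ) (z w : Plane) :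
    |((‖z‖ ^ 2) ^ (i + 1) - (‖w‖ ^ 2) ^ (i + 1)) * (⟪z, perp w⟫ / ‖z - w‖ ^ 2)
        - ((‖z‖ ^ 2) ^ i - (‖w‖ ^ 2) ^ i) * ⟪z, perp w⟫|
      ≤ (6 * i + 2) * (‖z‖ ^ 2 * (‖w‖ ^ 2) ^ i + ‖w‖ ^ 2 * (‖z‖ ^ 2) ^ i) := by
  rcases le_total ‖w‖ ‖z‖ with h | h
  · exact abs_moment_interaction_le_of_le i h
  · have := abs_moment_interaction_le_of_le i h
    rw [inner_perp_comm, norm_sub_rev] at this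
    rw [add_comm (‖z‖ ^ 2 * _)]
    refine le_trans (le_of_eq ?_) this
    congr 1; ring

/-! ### Concentrated vortices in Lagrangian variables -/

/-- Particles labelled by `α`, with positions `X t α` for `t ∈ [0, T]` and weighted by `μ`, that
move under their mutual vortex interaction of strength `c`, an `L`-Lipschitz field `G`, and a
perturbation `h` of size at most `B`. Initially they lie within distance `B` of `p₀`. The field
`near` says that the vorticity cannot concentrate on small discs; in the application it
comes from an `Lᵖ` bound with `p > 2`. No bound on `G` is assumed, and none is available
in the application: `G` may even fail to be integrable in time. -/
structure VortexFlow {Λ : Type*} [MeasurableSpace Λ] (μ : Measure Λ) (X : ℝ → Λ → Plane)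
    (G : ℝ → Plane → Plane) (h : ℝ → Λ → Plane) (p₀ : Plane) (L : ℝ≥0) (T c B N s : ℝ) :
    Prop where
  N_nonneg : 0 ≤ N
  B_nonneg : 0 ≤ B
  T_pos : 0 < T
  measurable_X : ∀ t ∈ Icc 0 T, Measurable (X t)
  continuousOn_X : ∀ α, ContinuousOn (fun t => X t α) (Icc 0 T)
  hasDerivAt_X : ∀ α, ∀ t ∈ Ioo 0 T, HasDerivAt (fun r => X r α)
    (c • ∫ α', kern (X t α - X t α') ∂μ + (G t (X t α) + h t α)) t
  lipschitz_G : ∀ t ∈ Ioo 0 T, LipschitzWith L (G t)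
  measurable_h : ∀ t ∈ Ioo 0 T, Measurable (h t)
  ae_norm_h_le : ∀ t ∈ Ioo 0 T, ∀ᵐ α ∂μ, ‖h t α‖ ≤ B
  ae_ae_norm_h_le : ∀ᵐ α ∂μ, ∀ᵐ t ∂(volume.restrict (Ioo 0 T)), ‖h t α‖ ≤ B
  near : ∀ t ∈ Icc 0 T, ∀ x : Plane, ∀ ρ : ℝ, 0 < ρ →
    ∫⁻ α in {α | ‖x - X t α‖ < ρ}, ENNReal.ofReal ‖x - X t α‖⁻¹ ∂μ ≤ ENNReal.ofReal (N * ρ ^ s)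
  initial : ∀ᵐ α ∂μ, ‖X 0 α - p₀‖ ≤ B

namespace VortexFlow

/-- The center of mass at time `t`. -/
noncomputable def center {Λ : Type*} [MeasurableSpace Λ] (μ : Measure Λ) (X : ℝ → Λ → Plane)
    (t : ℝ) : Plane := ∫ α, X t α ∂μ

/-- The position of a particle relative to the center of mass. -/
noncomputable def rel {Λ : Type*} [MeasurableSpace Λ] (μ : Measure Λ) (X : ℝ → Λ → Plane)
    (t : ℝ) (α : Λ) : Plane := X t α - center μ X t

/-- The non-interacting part of the velocity, relative to its mean. -/
noncomputable def drift {Λ : Type*} [MeasurableSpace Λ] (μ : Measure Λ) (X : ℝ → Λ → Plane)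
    (G : ℝ → Plane → Plane) (h : ℝ → Λ → Plane) (t : ℝ) (α : Λ) : Plane :=
  (G t (X t α) + h t α) - ∫ α', (G t (X t α') + h t α') ∂μ

/-- The moment of order `2 n` of the mass distribution about its center. -/
noncomputable def moment {Λ : Type*} [MeasurableSpace Λ] (μ : Measure Λ) (X : ℝ → Λ → Plane)
    (n : ℕ) (t : ℝ) : ℝ := ∫ α, (‖rel μ X t α‖ ^ 2) ^ n ∂μ

variable {Λ : Type*} [MeasurableSpace Λ] {μ : Measure Λ}
  {X : ℝ → Λ → Plane} {G : ℝ → Plane → Plane} {h : ℝ → Λ → Plane} {p₀ : Plane} {L : ℝ≥0}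
  {T c B N s : ℝ}

lemma lintegral_inv_dist_le (H : VortexFlow μ X G h p₀ L T c B N s) {t : ℝ} (ht : t ∈ Icc 0 T)
    (x : Plane) {S : Set Λ} (hS : MeasurableSet S) {ρ : ℝ} (hρ : 0 < ρ) :
    ∫⁻ α in S, ENNReal.ofReal ‖x - X t α‖⁻¹ ∂μ
      ≤ ENNReal.ofReal (N * ρ ^ s) + ENNReal.ofReal ρ⁻¹ * μ S := by
  have hX := H.measurable_X t ht
  set A : Set Λ := {α | ‖x - X t α‖ < ρ}
  have hA : MeasurableSet A := measurableSet_lt (by fun_prop) measurable_const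
  have hsub : S ⊆ A ∪ (S \ A) := by rw [union_sdiff_self]; exact subset_union_right
  calc _ ≤ ∫⁻ α in A ∪ (S \ A), ENNReal.ofReal ‖x - X t α‖⁻¹ ∂μ := lintegral_mono_set hsub
    _ ≤ ∫⁻ α in A, ENNReal.ofReal ‖x - X t α‖⁻¹ ∂μ
        + ∫⁻ α in S \ A, ENNReal.ofReal ‖x - X t α‖⁻¹ ∂μ := lintegral_union_le _ _ _
    _ ≤ _ := by
      refine add_le_add (H.near t ht x ρ hρ) ?_
      calc _ ≤ ∫⁻ _ in S \ A, ENNReal.ofReal ρ⁻¹ ∂μ := by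
            refine setLIntegral_mono' (hS.diff hA) fun α hα => ENNReal.ofReal_le_ofReal ?_
            exact inv_anti₀ hρ (not_lt.1 hα.2)
        _ ≤ _ := by
          rw [setLIntegral_const]
          gcongr
          exact sdiff_subset

lemma measurable_rel (H : VortexFlow μ X G h p₀ L T c B N s) {t : ℝ} (ht : t ∈ Icc 0 T) :
    Measurable (rel μ X t) := (H.measurable_X t ht).sub_const _

lemma moment_nonneg (n : ℕ) (t : ℝ) : 0 ≤ moment μ X n t :=
  integral_nonneg fun _ => by positivity

variable [IsProbabilityMeasure μ]

lemma integrable_inv_dist (H : VortexFlow μ X G h p₀ L T c B N s) {t : ℝ} (ht : t ∈ Icc 0 T)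
    (x : Plane) : Integrable (fun α => ‖x - X t α‖⁻¹) μ := by
  have hX := H.measurable_X t ht
  refine ⟨by fun_prop, ?_⟩
  rw [hasFiniteIntegral_iff_ofReal (ae_of_all _ fun _ => by positivity)]
  have := H.lintegral_inv_dist_le ht x MeasurableSet.univ one_pos
  rw [setLIntegral_univ] at this
  refine this.trans_lt ?_
  simp

lemma setIntegral_inv_dist_le (H : VortexFlow μ X G h p₀ L T c B N s) {t : ℝ}
    (ht : t ∈ Icc 0 T) (x : Plane) {S : Set Λ} (hS : MeasurableSet S) {ρ : ℝ} (hρ : 0 < ρ) :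
    ∫ α in S, ‖x - X t α‖⁻¹ ∂μ ≤ N * ρ ^ s + μ.real S / ρ := by
  have hX := H.measurable_X t ht
  have hN := H.N_nonneg
  rw [integral_eq_lintegral_of_nonneg_ae (ae_of_all _ fun α => by positivity) (by fun_prop)]
  refine ENNReal.toReal_le_of_le_ofReal (by positivity)
    ((H.lintegral_inv_dist_le ht x hS hρ).trans (le_of_eq ?_))
  rw [ENNReal.ofReal_add (by positivity) (by positivity), div_eq_inv_mul,
    ENNReal.ofReal_mul (p := ρ⁻¹) (by positivity), ofReal_measureReal]

lemma integral_inv_dist_le (H : VortexFlow μ X G h p₀ L T c B N s) {t : ℝ} (ht : t ∈ Icc 0 T)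
    (x : Plane) : ∫ α, ‖x - X t α‖⁻¹ ∂μ ≤ N + 1 := by
  simpa using H.setIntegral_inv_dist_le ht x MeasurableSet.univ one_pos

lemma integrable_kern (H : VortexFlow μ X G h p₀ L T c B N s) {t : ℝ} (ht : t ∈ Icc 0 T)
    (x : Plane) : Integrable (fun α => kern (x - X t α)) μ :=
  (H.integrable_inv_dist ht x).mono'
    (measurable_kern.comp ((H.measurable_X t ht).const_sub x)).aestronglyMeasurable
    (ae_of_all _ fun _ => (norm_kern _).le)

lemma norm_interaction_le (H : VortexFlow μ X G h p₀ L T c B N s) {t : ℝ} (ht : t ∈ Icc 0 T)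
    (x : Plane) : ‖∫ α, kern (x - X t α) ∂μ‖ ≤ N + 1 :=
  (norm_integral_le_integral_norm _).trans
    ((by simp_rw [norm_kern]; exact H.integral_inv_dist_le ht x))

lemma integrable_prod_inv_dist (H : VortexFlow μ X G h p₀ L T c B N s) {t : ℝ}
    (ht : t ∈ Icc 0 T) :
    Integrable (fun q : Λ × Λ => ‖X t q.1 - X t q.2‖⁻¹) (μ.prod μ) := by
  have hX := H.measurable_X t ht
  have hm : Measurable (fun q : Λ × Λ => ‖X t q.1 - X t q.2‖⁻¹) := by fun_prop
  refine (integrable_prod_iff hm.aestronglyMeasurable).2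
    ⟨ae_of_all _ fun α => H.integrable_inv_dist ht (X t α), ?_⟩
  refine Integrable.mono' (integrable_const (N + 1))
    hm.norm.stronglyMeasurable.integral_prod_right'.aestronglyMeasurable
    (ae_of_all _ fun _ => ?_)
  rw [Real.norm_of_nonneg (by positivity)]
  simpa using H.integral_inv_dist_le ht _

lemma integrable_prod_kern (H : VortexFlow μ X G h p₀ L T c B N s) {t : ℝ} (ht : t ∈ Icc 0 T) :
    Integrable (fun q : Λ × Λ => kern (X t q.1 - X t q.2)) (μ.prod μ) := by
  have hX := H.measurable_X t ht
  exact (H.integrable_prod_inv_dist ht).mono'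
    (measurable_kern.comp (by fun_prop)).aestronglyMeasurable
    (ae_of_all _ fun q => (norm_kern _).le)

/-- The total momentum of the mutual interaction vanishes, as the kernel is odd. -/
lemma integral_interaction_eq_zero (H : VortexFlow μ X G h p₀ L T c B N s) {t : ℝ}
    (ht : t ∈ Icc 0 T) : ∫ α, ∫ α', kern (X t α - X t α') ∂μ ∂μ = 0 := by
  rw [← integral_prod _ (H.integrable_prod_kern ht)]
  have h1 := integral_prod_swap (μ := μ) (ν := μ)
    (fun q : Λ × Λ => kern (X t q.1 - X t q.2))
  simp only [Prod.fst_swap, Prod.snd_swap] at h1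
  simp_rw [kern_sub_comm (X t (Prod.fst _)) (X t (Prod.snd _)), integral_neg] at h1
  have h2 := eq_neg_iff_add_eq_zero.1 h1.symm
  rw [← two_smul ℝ] at h2
  exact (smul_eq_zero.1 h2).resolve_left two_ne_zero

/-! ### The moving center -/

/-- Distances between particles stay bounded and are Lipschitz in time, although single
trajectories need not be. -/
lemma exists_reference (H : VortexFlow μ X G h p₀ L T c B N s) :
    ∃ β, ∃ K : ℝ≥0, ∀ᵐ α ∂μ, (∀ t ∈ Icc 0 T, ‖X t α - X t β‖ ≤ K) ∧
      LipschitzOnWith K (fun t => X t α - X t β) (Icc 0 T) := by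
  obtain ⟨β, hβ, hβ0⟩ := (H.ae_ae_norm_h_le.and H.initial).exists
  have hN := H.N_nonneg
  have hB := H.B_nonneg
  have hT := H.T_pos
  set K₀ : ℝ := 2 * (|c| * (N + 1) + B) with hK₀
  have hK₀0 : 0 ≤ K₀ := by positivity
  set Y : ℝ := Real.exp ((2 * L + 1) * T) * ((2 * B) ^ 2 + K₀ ^ 2 * T) with hY
  set K : ℝ := √Y + (L * √Y + K₀) with hK
  have hK0 : 0 ≤ K := by positivity
  -- `K₀` bounds the non-Lipschitz part of the relative velocity, and `Y` the squared distance
  refine ⟨β, K.toNNReal, ?_⟩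
  filter_upwards [H.ae_ae_norm_h_le, H.initial] with α hα hα0
  set D : ℝ → Plane := fun t => X t α - X t β with hD
  set D' : ℝ → Plane := fun t =>
    (c • ∫ α', kern (X t α - X t α') ∂μ + (G t (X t α) + h t α))
      - (c • ∫ α', kern (X t β - X t α') ∂μ + (G t (X t β) + h t β)) with hD'
  have hDc : ContinuousOn D (Icc 0 T) := (H.continuousOn_X α).sub (H.continuousOn_X β)
  have hDd : ∀ t ∈ Ioo 0 T, HasDerivAt D (D' t) t := fun t ht =>
    (H.hasDerivAt_X α t ht).sub (H.hasDerivAt_X β t ht)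
  have hbd : ∀ᵐ t ∂(volume.restrict (Ioo 0 T)), ‖D' t‖ ≤ L * ‖D t‖ + K₀ := by
    filter_upwards [hα, hβ, ae_restrict_mem measurableSet_Ioo] with t h1 h2 ht
    have hu : ∀ x, ‖c • ∫ α', kern (x - X t α') ∂μ‖ ≤ |c| * (N + 1) := fun x => by
      rw [norm_smul, Real.norm_eq_abs]
      exact mul_le_mul_of_nonneg_left (H.norm_interaction_le (Ioo_subset_Icc_self ht) x)
        (abs_nonneg c)
    have hG := (H.lipschitz_G t ht).norm_sub_le (X t α) (X t β)
    have e : D' t = (c • ∫ α', kern (X t α - X t α') ∂μ - c • ∫ α', kern (X t β - X t α') ∂μ)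
        + (G t (X t α) - G t (X t β)) + (h t α - h t β) := by simp only [hD']; abel
    rw [e]
    calc _ ≤ (‖c • ∫ α', kern (X t α - X t α') ∂μ‖ + ‖c • ∫ α', kern (X t β - X t α') ∂μ‖)
        + ‖G t (X t α) - G t (X t β)‖ + (‖h t α‖ + ‖h t β‖) :=
          norm_add₃_le.trans (add_le_add_three (norm_sub_le _ _) le_rfl (norm_sub_le _ _))
      _ ≤ _ := by linarith [hu (X t α), hu (X t β)]
  have hYb : ∀ t ∈ Icc 0 T, ‖D t‖ ≤ √Y := by
    intro t ht
    refine Real.le_sqrt_of_sq_le ?_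
    refine gronwall_of_ae_of_threshold (f := fun t => ‖D t‖ ^ 2) (f' := fun t => 2 * ⟪D t, D' t⟫)
      (K := 2 * L + 1) (c := K₀ ^ 2) (by positivity) (by positivity) (by positivity)
      (hDc.norm.pow 2) (fun t ht => (hDd t ht).norm_sq) ?_ ?_ ht
    · filter_upwards [hbd] with t h1 _
      have h2 := real_inner_le_norm (D t) (D' t)
      have h3 := mul_le_mul_of_nonneg_left h1 (norm_nonneg (D t))
      nlinarith [sq_nonneg (‖D t‖ - K₀)]
    · have : ‖D 0‖ ≤ 2 * B := by
        have : D 0 = (X 0 α - p₀) - (X 0 β - p₀) := by simp [hD]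
        rw [this]
        exact (norm_sub_le _ _).trans (by linarith)
      gcongr
  have hcK : (K.toNNReal : ℝ) = K := Real.coe_toNNReal _ hK0
  refine ⟨fun t ht => (hYb t ht).trans ?_, ?_⟩
  · rw [hcK]
    have : 0 ≤ L * √Y + K₀ := by positivity
    linarith
  · have key : ∀ a ∈ Icc 0 T, ∀ b ∈ Icc 0 T, a ≤ b → ‖D b - D a‖ ≤ K * (b - a) := by
      intro a ha b hb hab
      have hsub : Ioo a b ⊆ Ioo 0 T := Ioo_subset_Ioo ha.1 hb.2
      refine norm_sub_le_of_ae_norm_deriv_le hab (hDc.mono (Icc_subset_Icc ha.1 hb.2))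
        (fun t ht => hDd t (hsub ht)) ?_
      filter_upwards [ae_mono (Measure.restrict_mono hsub le_rfl) hbd,
        ae_restrict_mem measurableSet_Ioo] with t h1 ht
      have h2 := mul_le_mul_of_nonneg_left (hYb t (Ioo_subset_Icc_self (hsub ht))) L.coe_nonneg
      have h3 := Real.sqrt_nonneg Y
      linarith
    refine LipschitzOnWith.of_dist_le_mul fun a ha b hb => ?_
    rw [hcK, dist_eq_norm, Real.dist_eq]
    rcases le_total a b with hab | hab
    · rw [norm_sub_rev, abs_sub_comm, abs_of_nonneg (sub_nonneg.2 hab)]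
      exact key a ha b hb hab
    · rw [abs_of_nonneg (sub_nonneg.2 hab)]
      exact key b hb a ha hab

lemma integrable_X (H : VortexFlow μ X G h p₀ L T c B N s) {t : ℝ} (ht : t ∈ Icc 0 T) :
    Integrable (X t) μ := by
  obtain ⟨β, K, hK⟩ := H.exists_reference
  refine Integrable.of_bound (H.measurable_X t ht).aestronglyMeasurable (‖X t β‖ + K) ?_
  filter_upwards [hK] with α hα
  have := norm_le_norm_add_norm_sub' (X t α) (X t β)
  linarith [hα.1 t ht]

lemma exists_rel_bound (H : VortexFlow μ X G h p₀ L T c B N s) :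
    ∃ K : ℝ≥0, ∀ᵐ α ∂μ, (∀ t ∈ Icc 0 T, ‖rel μ X t α‖ ≤ K) ∧
      LipschitzOnWith K (fun t => rel μ X t α) (Icc 0 T) := by
  obtain ⟨β, K, hK⟩ := H.exists_reference
  have hrel : ∀ t ∈ Icc 0 T, ∀ α,
      rel μ X t α = (X t α - X t β) - ∫ α', (X t α' - X t β) ∂μ := by
    intro t ht α
    rw [integral_sub (H.integrable_X ht) (integrable_const _)]
    simp [rel, center]
  refine ⟨2 * K, ?_⟩
  filter_upwards [hK] with α hα
  refine ⟨fun t ht => ?_, LipschitzOnWith.of_dist_le_mul fun a ha b hb => ?_⟩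
  · rw [hrel t ht]
    have h1 : ‖∫ α', (X t α' - X t β) ∂μ‖ ≤ K := by
      simpa using norm_integral_le_of_norm_le_const (hK.mono fun α' h' => h'.1 t ht)
    push_cast
    linarith [norm_sub_le (X t α - X t β) (∫ α', (X t α' - X t β) ∂μ), hα.1 t ht]
  · have hi : ∀ t ∈ Icc 0 T, Integrable (fun α' => X t α' - X t β) μ := fun t ht =>
      (H.integrable_X ht).sub (integrable_const _)
    have h1 : ‖∫ α', ((X a α' - X a β) - (X b α' - X b β)) ∂μ‖ ≤ K * dist a b := by
      simpa using norm_integral_le_of_norm_le_const (C := K * dist a b) (μ := μ)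
        (hK.mono fun α' h' => by rw [← dist_eq_norm]; exact h'.2.dist_le_mul a ha b hb)
    have h2 := hα.2.dist_le_mul a ha b hb
    rw [integral_sub (hi a ha) (hi b hb)] at h1
    rw [dist_eq_norm] at h2
    rw [dist_eq_norm, hrel a ha, hrel b hb, sub_sub_sub_comm]
    push_cast
    linarith [norm_sub_le ((X a α - X a β) - (X b α - X b β))
      (∫ α', (X a α' - X a β) ∂μ - ∫ α', (X b α' - X b β) ∂μ)]

lemma integral_rel_eq_zero (H : VortexFlow μ X G h p₀ L T c B N s) {t : ℝ} (ht : t ∈ Icc 0 T) :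
    ∫ α, rel μ X t α ∂μ = 0 := by
  simp only [rel]
  rw [integral_sub (H.integrable_X ht) (integrable_const _)]
  simp [center]

lemma integrable_rel (H : VortexFlow μ X G h p₀ L T c B N s) {t : ℝ} (ht : t ∈ Icc 0 T) :
    Integrable (rel μ X t) μ := (H.integrable_X ht).sub (integrable_const _)

lemma integrable_field (H : VortexFlow μ X G h p₀ L T c B N s) {t : ℝ} (ht : t ∈ Ioo 0 T) :
    Integrable (fun α => G t (X t α)) μ := by
  have hX := H.integrable_X (Ioo_subset_Icc_self ht)
  refine ((integrable_const ‖G t 0‖).add (hX.norm.const_mul L)).mono'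
    ((H.lipschitz_G t ht).continuous.comp_aestronglyMeasurable hX.aestronglyMeasurable)
    (ae_of_all _ fun α => ?_)
  have h1 := (H.lipschitz_G t ht).norm_sub_le (X t α) 0
  have h2 := norm_le_norm_add_norm_sub' (G t (X t α)) (G t 0)
  simp only [sub_zero] at h1
  simp only [Pi.add_apply]
  linarith

lemma integrable_h (H : VortexFlow μ X G h p₀ L T c B N s) {t : ℝ} (ht : t ∈ Ioo 0 T) :
    Integrable (h t) μ :=
  Integrable.of_bound (H.measurable_h t ht).aestronglyMeasurable B (H.ae_norm_h_le t ht)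

lemma integrable_interaction (H : VortexFlow μ X G h p₀ L T c B N s) {t : ℝ}
    (ht : t ∈ Icc 0 T) : Integrable (fun α => ∫ α', kern (X t α - X t α') ∂μ) μ :=
  (H.integrable_prod_kern ht).integral_prod_left

lemma integrable_drift (H : VortexFlow μ X G h p₀ L T c B N s) {t : ℝ} (ht : t ∈ Ioo 0 T) :
    Integrable (drift μ X G h t) μ :=
  ((H.integrable_field ht).add (H.integrable_h ht)).sub (integrable_const _)

/-- The mutual interaction does not move the center. Differentiation under the integral is applied
to positions relative to a reference particle, as only these are Lipschitz in time. -/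
lemma hasDerivAt_center (H : VortexFlow μ X G h p₀ L T c B N s) {t : ℝ} (ht : t ∈ Ioo 0 T) :
    HasDerivAt (center μ X) (∫ α, (G t (X t α) + h t α) ∂μ) t := by
  obtain ⟨β, K, hK⟩ := H.exists_reference
  have htI := Ioo_subset_Icc_self ht
  have hv : ∀ t ∈ Ioo 0 T, Integrable
      (fun α => c • ∫ α', kern (X t α - X t α') ∂μ + (G t (X t α) + h t α)) μ := fun t ht =>
    ((H.integrable_interaction (Ioo_subset_Icc_self ht)).smul c).add
      ((H.integrable_field ht).add (H.integrable_h ht))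
  have hi : ∀ t ∈ Icc 0 T, Integrable (fun α' => X t α' - X t β) μ := fun t ht =>
      (H.integrable_X ht).sub (integrable_const _)
  have hnhds : Ioo 0 T ∈ 𝓝 t := Ioo_mem_nhds ht.1 ht.2
  set v : Λ → Plane := fun α => c • ∫ α', kern (X t α - X t α') ∂μ + (G t (X t α) + h t α)
    with hvdef
  have h1 := (hasDerivAt_integral_of_dominated_loc_of_lip (μ := μ) (𝕜 := ℝ)
    (F := fun t α => X t α - X t β) (F' := fun α => v α - v β)
    (bound := fun _ => (K : ℝ)) (x₀ := t) hnhds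
    (by filter_upwards [hnhds] with r hr using
          (hi r (Ioo_subset_Icc_self hr)).aestronglyMeasurable)
    (hi t htI) (((hv t ht).sub (integrable_const _)).aestronglyMeasurable)
    (by
      filter_upwards [hK] with α hα
      simpa using hα.2.mono Ioo_subset_Icc_self)
    (integrable_const _)
    (ae_of_all _ fun α => (H.hasDerivAt_X α t ht).sub (H.hasDerivAt_X β t ht))).2
  have h2 := h1.add (H.hasDerivAt_X β t ht)
  refine (h2.congr_deriv ?_).congr_of_eventuallyEq ?_
  · rw [integral_sub (hv t ht) (integrable_const _)]
    simp only [integral_const, probReal_univ, one_smul]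
    rw [sub_add_cancel, integral_add, integral_smul, H.integral_interaction_eq_zero htI]
    · simp
    · exact (H.integrable_interaction htI).smul c
    · exact (H.integrable_field ht).add (H.integrable_h ht)
  · filter_upwards [hnhds] with r hr
    simp only [Pi.add_apply]
    rw [integral_sub (H.integrable_X (Ioo_subset_Icc_self hr)) (integrable_const _)]
    simp [center]

lemma hasDerivAt_rel (H : VortexFlow μ X G h p₀ L T c B N s) {t : ℝ} (ht : t ∈ Ioo 0 T) (α : Λ) :
    HasDerivAt (fun r => rel μ X r α)
      (c • ∫ α', kern (rel μ X t α - rel μ X t α') ∂μ + drift μ X G h t α) t := by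
  simp only [rel, sub_sub_sub_cancel_right]
  refine ((H.hasDerivAt_X α t ht).sub (H.hasDerivAt_center ht)).congr_deriv ?_
  simp only [drift]; abel

/-- The drift is controlled through differences of `G` only, so no bound on `G` itself enters. -/
lemma norm_drift_le (H : VortexFlow μ X G h p₀ L T c B N s) {t : ℝ} (ht : t ∈ Ioo 0 T) {α : Λ}
    (hα : ‖h t α‖ ≤ B) :
    ‖drift μ X G h t α‖ ≤ L * ‖rel μ X t α‖ + (L * ∫ α', ‖rel μ X t α'‖ ∂μ + 2 * B) := by
  have hz := H.integrable_rel (Ioo_subset_Icc_self ht)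
  have hG := H.integrable_field ht
  have e : drift μ X G h t α
      = ∫ α', (G t (X t α) - G t (X t α')) ∂μ + (h t α - ∫ α', h t α' ∂μ) := by
    rw [drift, integral_add hG (H.integrable_h ht), integral_sub (integrable_const _) hG]
    simp only [integral_const, probReal_univ, one_smul]
    abel
  have h1 : ‖∫ α', (G t (X t α) - G t (X t α')) ∂μ‖
      ≤ L * ‖rel μ X t α‖ + L * ∫ α', ‖rel μ X t α'‖ ∂μ := by
    have h2 := norm_integral_le_of_norm_le (μ := μ)
      (f := fun α' => G t (X t α) - G t (X t α'))
      (g := fun α' => L * ‖rel μ X t α‖ + L * ‖rel μ X t α'‖)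
      ((integrable_const _).add (hz.norm.const_mul _)) (ae_of_all _ fun α' => by
        have h3 := (H.lipschitz_G t ht).norm_sub_le (X t α) (X t α')
        have h4 : X t α - X t α' = rel μ X t α - rel μ X t α' := by simp [rel]
        rw [h4] at h3
        refine h3.trans ?_
        rw [← mul_add]
        exact mul_le_mul_of_nonneg_left (norm_sub_le _ _) L.coe_nonneg)
    rw [integral_add (integrable_const _) (hz.norm.const_mul _)] at h2
    simpa [integral_const_mul] using h2
  have h5 : ‖∫ α', h t α' ∂μ‖ ≤ B := by
    simpa using norm_integral_le_of_norm_le_const (H.ae_norm_h_le t ht)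
  rw [e]
  calc _ ≤ _ := norm_add_le_of_le h1 (norm_sub_le_of_le hα h5)
    _ = _ := by ring

/-! ### Evolution of the moments -/

lemma integrable_comp_rel (H : VortexFlow μ X G h p₀ L T c B N s) {t : ℝ} (ht : t ∈ Icc 0 T)
    {f : Plane → ℝ} (hf : Continuous f) : Integrable (fun α => f (rel μ X t α)) μ := by
  obtain ⟨K, hK⟩ := H.exists_rel_bound
  obtain ⟨M, hM⟩ := (isCompact_closedBall (0 : Plane) K).exists_bound_of_continuousOn
    hf.continuousOn
  refine Integrable.of_bound (hf.measurable.comp (H.measurable_rel ht)).aestronglyMeasurable M ?_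
  filter_upwards [hK] with α hα
  exact hM _ (by simpa using hα.1 t ht)

lemma continuousOn_moment (H : VortexFlow μ X G h p₀ L T c B N s) (n : ℕ) :
    ContinuousOn (moment μ X n) (Icc 0 T) := by
  obtain ⟨K, hK⟩ := H.exists_rel_bound
  refine continuousOn_of_dominated (bound := fun _ => ((K : ℝ) ^ 2) ^ n)
    (fun t ht => (H.integrable_comp_rel ht
      (f := fun z => (‖z‖ ^ 2) ^ n) (by fun_prop)).aestronglyMeasurable)
    (fun t ht => ?_) (integrable_const _) ?_
  · filter_upwards [hK] with α hα
    have := hα.1 t ht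
    rw [Real.norm_of_nonneg (by positivity)]
    gcongr
  · filter_upwards [hK] with α hα
    exact (hα.2.continuousOn.norm.pow 2).pow n

lemma hasDerivAt_moment (H : VortexFlow μ X G h p₀ L T c B N s) (n : ℕ) {t : ℝ}
    (ht : t ∈ Ioo 0 T) :
    Integrable (fun α => (n + 1) * (‖rel μ X t α‖ ^ 2) ^ n * (2 * ⟪rel μ X t α,
        c • ∫ α', kern (rel μ X t α - rel μ X t α') ∂μ + drift μ X G h t α⟫)) μ ∧
    HasDerivAt (moment μ X (n + 1)) (∫ α, (n + 1) * (‖rel μ X t α‖ ^ 2) ^ n *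
      (2 * ⟪rel μ X t α,
        c • ∫ α', kern (rel μ X t α - rel μ X t α') ∂μ + drift μ X G h t α⟫) ∂μ) t := by
  obtain ⟨K, hK⟩ := H.exists_rel_bound
  have hnhds : Ioo 0 T ∈ 𝓝 t := Ioo_mem_nhds ht.1 ht.2
  have htI := Ioo_subset_Icc_self ht
  have hm : AEStronglyMeasurable (fun α =>
      c • ∫ α', kern (rel μ X t α - rel μ X t α') ∂μ + drift μ X G h t α) μ := by
    simp only [rel, sub_sub_sub_cancel_right]
    exact (((H.integrable_interaction htI).smul c).add (H.integrable_drift ht)).aestronglyMeasurable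
  have hz := (H.measurable_rel htI).aestronglyMeasurable (μ := μ)
  refine hasDerivAt_integral_of_dominated_loc_of_lip (μ := μ) (𝕜 := ℝ)
    (F := fun t α => (‖rel μ X t α‖ ^ 2) ^ (n + 1))
    (bound := fun _ => 2 * K ^ 2 * (n + 1) * ((K : ℝ) ^ 2) ^ n) hnhds ?_
    (H.integrable_comp_rel htI (f := fun z => (‖z‖ ^ 2) ^ (n + 1)) (by fun_prop)) ?_ ?_
    (integrable_const _) (ae_of_all _ fun α => ?_)
  · filter_upwards [hnhds] with r hr
    exact (H.integrable_comp_rel (Ioo_subset_Icc_self hr)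
      (f := fun z => (‖z‖ ^ 2) ^ (n + 1)) (by fun_prop)).aestronglyMeasurable
  · exact (((hz.norm.pow 2).pow n).const_mul _).mul ((hz.inner hm).const_mul 2)
  · filter_upwards [hK] with α hα
    refine LipschitzOnWith.of_dist_le_mul fun a ha b hb => ?_
    have ha' := Ioo_subset_Icc_self ha
    have hb' := Ioo_subset_Icc_self hb
    have h1 := hα.1 a ha'
    have h2 := hα.1 b hb'
    have h3 := hα.2.dist_le_mul a ha' b hb'
    rw [dist_eq_norm] at h3
    have h4 := (abs_norm_sub_norm_le _ _).trans h3
    rw [Real.coe_nnabs, abs_of_nonneg (by positivity), Real.dist_eq]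
    have h5 : |‖rel μ X a α‖ ^ 2 - ‖rel μ X b α‖ ^ 2| ≤ 2 * K * (K * dist a b) := by
      rw [sq_sub_sq, abs_mul, abs_of_nonneg (by positivity)]
      gcongr
      linarith
    have h6 := abs_pow_sub_pow_le (‖rel μ X a α‖ ^ 2) (‖rel μ X b α‖ ^ 2) (n + 1)
    rw [abs_of_nonneg (sq_nonneg ‖rel μ X a α‖), abs_of_nonneg (sq_nonneg ‖rel μ X b α‖),
      Nat.add_sub_cancel] at h6
    refine h6.trans ?_
    have h7 : max (‖rel μ X a α‖ ^ 2) (‖rel μ X b α‖ ^ 2) ≤ (K : ℝ) ^ 2 :=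
      max_le (by gcongr) (by gcongr)
    calc _ ≤ 2 * K * (K * dist a b) * ↑(n + 1) * ((K : ℝ) ^ 2) ^ n := by
          gcongr
      _ = _ := by push_cast; ring
  · have := ((H.hasDerivAt_rel ht α).norm_sq).pow (n + 1)
    refine this.congr_deriv ?_
    simp

lemma integrable_prod_comp_rel (H : VortexFlow μ X G h p₀ L T c B N s) {t : ℝ}
    (ht : t ∈ Icc 0 T) {f : Plane × Plane → ℝ} (hf : Continuous f) :
    Integrable (fun q : Λ × Λ => f (rel μ X t q.1, rel μ X t q.2)) (μ.prod μ) := by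
  have hm := H.measurable_rel ht
  obtain ⟨K, hK⟩ := H.exists_rel_bound
  obtain ⟨M, hM⟩ := ((isCompact_closedBall (0 : Plane) K).prod
    (isCompact_closedBall (0 : Plane) K)).exists_bound_of_continuousOn hf.continuousOn
  refine Integrable.of_bound (hf.measurable.comp (by fun_prop)).aestronglyMeasurable M ?_
  filter_upwards [Measure.quasiMeasurePreserving_fst.ae hK,
    Measure.quasiMeasurePreserving_snd.ae hK] with q h1 h2
  exact hM _ ⟨by simpa using h1.1 t ht, by simpa using h2.1 t ht⟩

lemma integrable_prod_inner_kern (H : VortexFlow μ X G h p₀ L T c B N s) {t : ℝ}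
    (ht : t ∈ Icc 0 T) (n : ℕ) :
    Integrable (fun q : Λ × Λ => (‖rel μ X t q.1‖ ^ 2) ^ n *
      ⟪rel μ X t q.1, kern (rel μ X t q.1 - rel μ X t q.2)⟫) (μ.prod μ) := by
  have hm := H.measurable_rel ht
  obtain ⟨K, hK⟩ := H.exists_rel_bound
  have hk : Measurable (fun q : Λ × Λ => kern (rel μ X t q.1 - rel μ X t q.2)) :=
    measurable_kern.comp (by fun_prop)
  refine ((H.integrable_prod_inv_dist ht).const_mul (((K : ℝ) ^ 2) ^ n * K)).mono'
    (by fun_prop) ?_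
  filter_upwards [Measure.quasiMeasurePreserving_fst.ae hK] with q h1
  have h2 := h1.1 t ht
  have h3 := norm_inner_le_norm (𝕜 := ℝ) (rel μ X t q.1) (kern (rel μ X t q.1 - rel μ X t q.2))
  rw [norm_kern] at h3
  have h4 : rel μ X t q.1 - rel μ X t q.2 = X t q.1 - X t q.2 := by simp [rel]
  rw [norm_mul, norm_pow, norm_pow, norm_norm, mul_assoc, ← h4]
  refine mul_le_mul (by gcongr) (h3.trans ?_) (norm_nonneg _) (by positivity)
  gcongr

lemma integral_inner_perp_eq_zero (H : VortexFlow μ X G h p₀ L T c B N s) {t : ℝ}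
    (ht : t ∈ Icc 0 T) (z : Plane) : ∫ α, ⟪z, perp (rel μ X t α)⟫ ∂μ = 0 := by
  have hi := H.integrable_rel ht
  have h1 : ∫ α, ⟪z, perpL (rel μ X t α)⟫ ∂μ = ⟪z, ∫ α, perpL (rel μ X t α) ∂μ⟫ :=
    integral_inner (perpL.integrable_comp hi) z
  rw [perpL.integral_comp_comm hi, H.integral_rel_eq_zero ht, map_zero, inner_zero_right] at h1
  simpa [perpL_apply] using h1

lemma integral_inner_interaction (H : VortexFlow μ X G h p₀ L T c B N s) {t : ℝ}
    (ht : t ∈ Icc 0 T) (n : ℕ) :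
    ∫ α, (‖rel μ X t α‖ ^ 2) ^ n *
        ⟪rel μ X t α, ∫ α', kern (rel μ X t α - rel μ X t α') ∂μ⟫ ∂μ
      = ∫ q : Λ × Λ, (‖rel μ X t q.1‖ ^ 2) ^ n *
        ⟪rel μ X t q.1, kern (rel μ X t q.1 - rel μ X t q.2)⟫ ∂(μ.prod μ) := by
  rw [integral_prod _ (H.integrable_prod_inner_kern ht n)]
  refine integral_congr_ae (ae_of_all _ fun α => ?_)
  simp only
  rw [integral_const_mul, integral_inner]
  simpa [rel] using H.integrable_kern ht (X t α)

lemma integral_inner_interaction_zero (H : VortexFlow μ X G h p₀ L T c B N s) {t : ℝ}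
    (ht : t ∈ Icc 0 T) :
    ∫ α, ⟪rel μ X t α, ∫ α', kern (rel μ X t α - rel μ X t α') ∂μ⟫ ∂μ = 0 := by
  have h0 := H.integral_inner_interaction ht 0
  have h1 := integral_prod_swap (μ := μ) (ν := μ) (fun q : Λ × Λ =>
    ⟪rel μ X t q.1, kern (rel μ X t q.1 - rel μ X t q.2)⟫)
  simp only [pow_zero, one_mul] at h0
  rw [h0]
  have h2 : ∀ q : Λ × Λ,
      ⟪rel μ X t q.swap.1, kern (rel μ X t q.swap.1 - rel μ X t q.swap.2)⟫
        = -⟪rel μ X t q.1, kern (rel μ X t q.1 - rel μ X t q.2)⟫ := fun q => by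
    simp only [Prod.fst_swap, Prod.snd_swap]
    rw [kern_sub_comm, inner_neg_right, inner_kern_sub_left, inner_kern_sub_right]
  simp_rw [h2, integral_neg] at h1
  linarith

/-- The contribution of the mutual interaction to the growth of the moment of order `2 i + 4`. -/
lemma abs_integral_inner_interaction_le (H : VortexFlow μ X G h p₀ L T c B N s) {t : ℝ}
    (ht : t ∈ Icc 0 T) (i : ℕ) :
    |∫ α, (‖rel μ X t α‖ ^ 2) ^ (i + 1) *
        ⟪rel μ X t α, ∫ α', kern (rel μ X t α - rel μ X t α') ∂μ⟫ ∂μ|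
      ≤ (6 * i + 2) * (moment μ X 1 t * moment μ X i t) := by
  rw [H.integral_inner_interaction ht]
  set Z : Λ → Plane := rel μ X t with hZ
  set E₁ : Λ × Λ → ℝ := fun q => (‖Z q.1‖ ^ 2) ^ (i + 1) * ⟪Z q.1, kern (Z q.1 - Z q.2)⟫ with hE₁
  set E₂ : Λ × Λ → ℝ := fun q => (‖Z q.1‖ ^ 2) ^ i * ⟪Z q.1, perp (Z q.2)⟫ with hE₂
  have hI₁ : Integrable E₁ (μ.prod μ) := H.integrable_prod_inner_kern ht (i + 1)
  have hI₂ : Integrable E₂ (μ.prod μ) := H.integrable_prod_comp_rel ht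
    (f := fun q => (‖q.1‖ ^ 2) ^ i * ⟪q.1, perp q.2⟫)
    (by have := continuous_perp; fun_prop)
  -- the center of mass is at the origin, so this correction is free
  have h₂ : ∫ q, E₂ q ∂(μ.prod μ) = 0 := by
    rw [integral_prod _ hI₂]
    simp only [hE₂, integral_const_mul]
    simp [hZ, H.integral_inner_perp_eq_zero ht]
  have hI : Integrable (fun q => E₁ q + E₂ q) (μ.prod μ) := hI₁.add hI₂
  have hsum : ∫ q, E₁ q ∂(μ.prod μ) = ∫ q, (E₁ q + E₂ q) ∂(μ.prod μ) := by
    rw [integral_add hI₁ hI₂, h₂, add_zero]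
  have hsymm : 2 * ∫ q, E₁ q ∂(μ.prod μ)
      = ∫ q, ((E₁ q + E₂ q) + (E₁ q.swap + E₂ q.swap)) ∂(μ.prod μ) := by
    have hIs : Integrable (fun q : Λ × Λ => E₁ q.swap + E₂ q.swap) (μ.prod μ) := hI.swap
    rw [integral_add hI hIs, hsum,
      integral_prod_swap (μ := μ) (ν := μ) (fun q : Λ × Λ => E₁ q + E₂ q)]
    ring
  have hpt : ∀ q : Λ × Λ, ‖(E₁ q + E₂ q) + (E₁ q.swap + E₂ q.swap)‖ ≤
      (6 * i + 2) * (‖Z q.1‖ ^ 2 * (‖Z q.2‖ ^ 2) ^ i + (‖Z q.1‖ ^ 2) ^ i * ‖Z q.2‖ ^ 2) := by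
    intro q
    have := abs_moment_interaction_le i (Z q.1) (Z q.2)
    rw [mul_comm (‖Z q.2‖ ^ 2) ((‖Z q.1‖ ^ 2) ^ i)] at this
    refine le_trans (le_of_eq ?_) this
    simp only [hE₁, hE₂, Prod.fst_swap, Prod.snd_swap]
    rw [Real.norm_eq_abs, ← abs_neg, kern_sub_comm (Z q.1) (Z q.2), inner_neg_right,
      inner_kern_sub_left, inner_kern_sub_right, inner_perp_comm (Z q.1) (Z q.2)]
    congr 1; ring
  have hP : Integrable (fun α => ‖Z α‖ ^ 2) μ :=
    H.integrable_comp_rel ht (f := fun z => ‖z‖ ^ 2) (by fun_prop)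
  have hQ : Integrable (fun α => (‖Z α‖ ^ 2) ^ i) μ :=
    H.integrable_comp_rel ht (f := fun z => (‖z‖ ^ 2) ^ i) (by fun_prop)
  have hPQ : Integrable (fun q : Λ × Λ => ‖Z q.1‖ ^ 2 * (‖Z q.2‖ ^ 2) ^ i
      + (‖Z q.1‖ ^ 2) ^ i * ‖Z q.2‖ ^ 2) (μ.prod μ) := (hP.mul_prod hQ).add (hQ.mul_prod hP)
  have hbound := norm_integral_le_of_norm_le (hPQ.const_mul (6 * (i : ℝ) + 2))
    (ae_of_all (μ.prod μ) hpt)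
  have e1 := integral_prod_mul (μ := μ) (ν := μ) (fun α => ‖Z α‖ ^ 2) (fun α => (‖Z α‖ ^ 2) ^ i)
  have e2 := integral_prod_mul (μ := μ) (ν := μ) (fun α => (‖Z α‖ ^ 2) ^ i) (fun α => ‖Z α‖ ^ 2)
  rw [integral_const_mul, integral_add (hP.mul_prod hQ) (hQ.mul_prod hP), ← hsymm, e1, e2,
    Real.norm_eq_abs, abs_mul, abs_two] at hbound
  simp only [moment, pow_one]
  simp only [← hZ]
  linarith

lemma moment_zero_eq (t : ℝ) : moment μ X 0 t = 1 := by simp [moment]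

lemma sq_integral_norm_rel_le (H : VortexFlow μ X G h p₀ L T c B N s) {t : ℝ} (ht : t ∈ Icc 0 T) :
    (∫ α, ‖rel μ X t α‖ ∂μ) ^ 2 ≤ moment μ X 1 t := by
  set m := ∫ α, ‖rel μ X t α‖ ∂μ with hm
  have hi := (H.integrable_rel ht).norm
  have hP : Integrable (fun α => ‖rel μ X t α‖ ^ 2) μ :=
    H.integrable_comp_rel ht (f := fun z => ‖z‖ ^ 2) (by fun_prop)
  have hPi : Integrable (fun α => ‖rel μ X t α‖ ^ 2 - 2 * m * ‖rel μ X t α‖) μ :=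
    hP.sub (hi.const_mul _)
  have h0 : 0 ≤ ∫ α, (‖rel μ X t α‖ - m) ^ 2 ∂μ := integral_nonneg fun α => sq_nonneg _
  have h1 : ∫ α, (‖rel μ X t α‖ - m) ^ 2 ∂μ
      = ∫ α, (‖rel μ X t α‖ ^ 2 - 2 * m * ‖rel μ X t α‖ + m ^ 2) ∂μ := by
    congr 1; ext α; ring
  rw [h1, integral_add hPi (integrable_const _),
    integral_sub hP (hi.const_mul _), integral_const_mul, ← hm] at h0
  simp only [integral_const, probReal_univ, one_smul] at h0
  simp only [moment, pow_one]
  linarith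

lemma norm_rel_zero_le (H : VortexFlow μ X G h p₀ L T c B N s) :
    ∀ᵐ α ∂μ, ‖rel μ X 0 α‖ ≤ 2 * B := by
  have ht : (0 : ℝ) ∈ Icc 0 T := ⟨le_rfl, H.T_pos.le⟩
  filter_upwards [H.initial] with α hα
  have h1 : ‖∫ α', (X 0 α' - p₀) ∂μ‖ ≤ B := by
    simpa using norm_integral_le_of_norm_le_const H.initial
  have h2 : rel μ X 0 α = (X 0 α - p₀) - ∫ α', (X 0 α' - p₀) ∂μ := by
    rw [integral_sub (H.integrable_X ht) (integrable_const _)]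
    simp [rel, center]
  rw [h2]
  linarith [norm_sub_le (X 0 α - p₀) (∫ α', (X 0 α' - p₀) ∂μ)]

lemma moment_initial_le (H : VortexFlow μ X G h p₀ L T c B N s) (n : ℕ) :
    moment μ X n 0 ≤ ((2 * B) ^ 2) ^ n := by
  have ht : (0 : ℝ) ∈ Icc 0 T := ⟨le_rfl, H.T_pos.le⟩
  have h1 := integral_mono_ae (H.integrable_comp_rel ht (f := fun z => (‖z‖ ^ 2) ^ n)
    (by fun_prop)) (integrable_const (((2 * B) ^ 2) ^ n)) (by
      filter_upwards [H.norm_rel_zero_le] with α hα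
      gcongr)
  simpa [moment] using h1

/-- The derivative of a moment, with the interaction and the drift separated. -/
lemma hasDerivAt_moment_split (H : VortexFlow μ X G h p₀ L T c B N s) (n : ℕ) {t : ℝ}
    (ht : t ∈ Ioo 0 T) :
    Integrable (fun α => (‖rel μ X t α‖ ^ 2) ^ n * ⟪rel μ X t α, drift μ X G h t α⟫) μ ∧
    HasDerivAt (moment μ X (n + 1)) (2 * (n + 1) *
      (c * ∫ α, (‖rel μ X t α‖ ^ 2) ^ n *
          ⟪rel μ X t α, ∫ α', kern (rel μ X t α - rel μ X t α') ∂μ⟫ ∂μ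
        + ∫ α, (‖rel μ X t α‖ ^ 2) ^ n * ⟪rel μ X t α, drift μ X G h t α⟫ ∂μ)) t := by
  obtain ⟨hi, hd⟩ := H.hasDerivAt_moment n ht
  have htI := Ioo_subset_Icc_self ht
  have hu : Integrable (fun α => (‖rel μ X t α‖ ^ 2) ^ n *
      ⟪rel μ X t α, ∫ α', kern (rel μ X t α - rel μ X t α') ∂μ⟫) μ := by
    refine (H.integrable_prod_inner_kern htI n).integral_prod_left.congr (ae_of_all _ fun α => ?_)
    simp only
    rw [integral_const_mul, integral_inner]
    simpa [rel] using H.integrable_kern htI (X t α)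
  have e : ∀ α, (n + 1) * (‖rel μ X t α‖ ^ 2) ^ n * (2 * ⟪rel μ X t α,
        c • ∫ α', kern (rel μ X t α - rel μ X t α') ∂μ + drift μ X G h t α⟫)
      = 2 * (n + 1) * (c * ((‖rel μ X t α‖ ^ 2) ^ n *
          ⟪rel μ X t α, ∫ α', kern (rel μ X t α - rel μ X t α') ∂μ⟫)
        + (‖rel μ X t α‖ ^ 2) ^ n * ⟪rel μ X t α, drift μ X G h t α⟫) := by
    intro α
    rw [inner_add_right, inner_smul_right]; ring
  have hf : Integrable (fun α => (‖rel μ X t α‖ ^ 2) ^ n *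
      ⟪rel μ X t α, drift μ X G h t α⟫) μ := by
    refine ((hi.const_mul (2 * ((n : ℝ) + 1))⁻¹).sub (hu.const_mul c)).congr
      (ae_of_all _ fun α => ?_)
    simp only [Pi.sub_apply, e]
    field_simp; ring
  refine ⟨hf, hd.congr_deriv ?_⟩
  simp_rw [e]
  rw [integral_const_mul, integral_add (hu.const_mul c) hf, integral_const_mul]

lemma integral_pow_mul_inner_drift_le (H : VortexFlow μ X G h p₀ L T c B N s) (n : ℕ) {t : ℝ}
    (ht : t ∈ Ioo 0 T) :
    ∫ α, (‖rel μ X t α‖ ^ 2) ^ n * ⟪rel μ X t α, drift μ X G h t α⟫ ∂μ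
      ≤ ∫ α, (‖rel μ X t α‖ ^ 2) ^ n * (‖rel μ X t α‖ * (L * ‖rel μ X t α‖
          + (L * ∫ α', ‖rel μ X t α'‖ ∂μ + 2 * B))) ∂μ := by
  refine integral_mono_ae (H.hasDerivAt_moment_split n ht).1
    (H.integrable_comp_rel (Ioo_subset_Icc_self ht) (f := fun z => (‖z‖ ^ 2) ^ n *
      (‖z‖ * (L * ‖z‖ + (L * ∫ α', ‖rel μ X t α'‖ ∂μ + 2 * B)))) (by fun_prop)) ?_
  filter_upwards [H.ae_norm_h_le t ht] with α hα
  exact mul_le_mul_of_nonneg_left ((real_inner_le_norm _ _).trans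
    (mul_le_mul_of_nonneg_left (H.norm_drift_le ht hα) (norm_nonneg _))) (by positivity)

/-- The interaction conserves the moment of inertia, which therefore stays of the order of the
square of the initial radius. -/
lemma moment_one_le (H : VortexFlow μ X G h p₀ L T c B N s) {t : ℝ} (ht : t ∈ Icc 0 T) :
    moment μ X 1 t ≤ Real.exp ((4 * L + 1) * T) * (4 + 4 * T) * B ^ 2 := by
  have h0 := H.moment_initial_le 1
  rw [pow_one] at h0
  have := gronwall_of_ae_of_threshold (K := 4 * L + 1) (c := 4 * B ^ 2) (by positivity)
    (by positivity) (by positivity) (H.continuousOn_moment 1)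
    (fun r hr => (H.hasDerivAt_moment_split 0 hr).2) (by
      filter_upwards [ae_restrict_mem measurableSet_Ioo] with r hr _
      have hrI := Ioo_subset_Icc_self hr
      have h1 := H.integral_pow_mul_inner_drift_le 0 hr
      have h2 := H.sq_integral_norm_rel_le hrI
      have h3 := H.integral_inner_interaction_zero hrI
      have hP : Integrable (fun α => ‖rel μ X r α‖ ^ 2) μ :=
        H.integrable_comp_rel hrI (f := fun z => ‖z‖ ^ 2) (by fun_prop)
      simp only [pow_zero, one_mul] at h1 ⊢
      rw [h3]
      set m := ∫ α, ‖rel μ X r α‖ ∂μ with hm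
      have h4 : ∫ α, ‖rel μ X r α‖ * (L * ‖rel μ X r α‖ + (L * m + 2 * B)) ∂μ
          = L * moment μ X 1 r + (L * m + 2 * B) * m := by
        have e : ∀ α, ‖rel μ X r α‖ * (L * ‖rel μ X r α‖ + (L * m + 2 * B))
            = L * ‖rel μ X r α‖ ^ 2 + (L * m + 2 * B) * ‖rel μ X r α‖ := fun α => by ring
        simp_rw [e]
        rw [integral_add (hP.const_mul _) ((H.integrable_rel hrI).norm.const_mul _),
          integral_const_mul, integral_const_mul]
        simp only [moment, pow_one, hm]
      rw [h4] at h1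
      have h5 := mul_le_mul_of_nonneg_left h2 L.coe_nonneg
      simp only [CharP.cast_eq_zero, zero_add, mul_one, mul_zero]
      nlinarith [sq_nonneg (m - 2 * B)]) h0 ht
  refine this.trans (le_of_eq ?_)
  ring

/-- The constant in the bound of the moment of inertia by the square of the initial radius. -/
noncomputable def inertiaConst (L : ℝ≥0) (T : ℝ) : ℝ :=
  Real.exp ((4 * L + 1) * T) * (4 + 4 * T)

/-- The constant in the bound of the part of the drift that is not Lipschitz in the distance from
the center. -/
noncomputable def driftConst (L : ℝ≥0) (T : ℝ) : ℝ := L * √(inertiaConst L T) + 2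

lemma drift_offset_le (H : VortexFlow μ X G h p₀ L T c B N s) {t : ℝ} (ht : t ∈ Icc 0 T) :
    L * ∫ α, ‖rel μ X t α‖ ∂μ + 2 * B ≤ driftConst L T * B := by
  have h1 : ∫ α, ‖rel μ X t α‖ ∂μ ≤ √(inertiaConst L T) * B := by
    rw [← Real.sqrt_sq H.B_nonneg, ← Real.sqrt_mul' _ (sq_nonneg B)]
    exact Real.le_sqrt_of_sq_le ((H.sq_integral_norm_rel_le ht).trans (H.moment_one_le ht))
  have h2 := mul_le_mul_of_nonneg_left h1 L.coe_nonneg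
  rw [driftConst]
  linarith

lemma integral_pow_mul_inner_drift_le_moment (H : VortexFlow μ X G h p₀ L T c B N s) (n : ℕ)
    {t : ℝ} (ht : t ∈ Ioo 0 T) :
    ∫ α, (‖rel μ X t α‖ ^ 2) ^ n * ⟪rel μ X t α, drift μ X G h t α⟫ ∂μ
      ≤ (L + 1) * moment μ X (n + 1) t + ((driftConst L T * B) ^ 2) ^ (n + 1) := by
  have htI := Ioo_subset_Icc_self ht
  have hB0 := H.B_nonneg
  have h3 := H.drift_offset_le htI
  refine (H.integral_pow_mul_inner_drift_le n ht).trans ?_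
  set D₀ := L * ∫ α, ‖rel μ X t α‖ ∂μ + 2 * B with hD₀
  have hD₀0 : 0 ≤ D₀ := by positivity
  set D := driftConst L T * B
  have hD : 0 ≤ D := hD₀0.trans h3
  have hP : Integrable (fun α => (‖rel μ X t α‖ ^ 2) ^ (n + 1)) μ :=
    H.integrable_comp_rel htI (f := fun z => (‖z‖ ^ 2) ^ (n + 1)) (by fun_prop)
  have hpt : ∀ z : ℝ, 0 ≤ z → (z ^ 2) ^ n * (z * (L * z + D₀))
      ≤ (L + 1) * (z ^ 2) ^ (n + 1) + (D ^ 2) ^ (n + 1) := by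
    intro z hz
    have hzD : (z ^ 2) ^ n * (z * D) ≤ (z ^ 2) ^ (n + 1) + (D ^ 2) ^ (n + 1) := by
      rcases le_total z D with hle | hle
      · calc _ ≤ (D ^ 2) ^ n * (D * D) := by gcongr
          _ = (D ^ 2) ^ (n + 1) := by ring
          _ ≤ _ := le_add_of_nonneg_left (by positivity)
      · calc _ ≤ (z ^ 2) ^ n * (z * z) := by gcongr
          _ = (z ^ 2) ^ (n + 1) := by ring
          _ ≤ _ := le_add_of_nonneg_right (by positivity)
    calc _ ≤ (z ^ 2) ^ n * (z * (L * z + D)) := by gcongr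
      _ = L * (z ^ 2) ^ (n + 1) + (z ^ 2) ^ n * (z * D) := by ring
      _ ≤ _ := by linarith
  have h6 := integral_mono (μ := μ)
    (H.integrable_comp_rel htI (f := fun z => (‖z‖ ^ 2) ^ n * (‖z‖ * (L * ‖z‖ + D₀)))
      (by fun_prop))
    ((hP.const_mul ((L : ℝ) + 1)).add (integrable_const ((D ^ 2) ^ (n + 1))))
    (fun α => hpt _ (norm_nonneg _))
  refine h6.trans (le_of_eq ?_)
  simp only [Pi.add_apply]
  rw [integral_add (hP.const_mul _) (integrable_const _), integral_const_mul]
  simp [moment]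

/-- The moment of order `4 k` stays of the order of the `2 k`-th power of the initial radius. -/
lemma exists_moment_bound (Λ : Type*) [MeasurableSpace Λ] (L : ℝ≥0) {T C : ℝ} (hT : 0 < T)
    (hC : 0 ≤ C) (k : ℕ) :
    ∃ K : ℝ, 0 ≤ K ∧ ∀ (μ : Measure Λ) [IsProbabilityMeasure μ] (X : ℝ → Λ → Plane)
      (G : ℝ → Plane → Plane) (h : ℝ → Λ → Plane) (p₀ : Plane) (c B N s : ℝ),
      VortexFlow μ X G h p₀ L T c B N s → |c| ≤ C → B ≤ 1 →
      ∀ t ∈ Icc 0 T, moment μ X (2 * k) t ≤ K * B ^ (2 * k) := by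
  induction k with
  | zero => exact ⟨1, zero_le_one, fun μ _ X G h p₀ c B N s _ _ _ t _ => by simp [moment_zero_eq]⟩
  | succ k ih =>
    obtain ⟨K, hK0, hK⟩ := ih
    have hI0 : 0 ≤ inertiaConst L T := by unfold inertiaConst; positivity
    have e2 : 2 * (k + 1) = 2 * k + 1 + 1 := by ring
    rw [e2]
    generalize 2 * k = i at *
    set a : ℝ := 2 * (((i + 1 : ℕ) : ℝ) + 1) with ha
    have ha0 : 0 ≤ a := by positivity
    set Q₁ : ℝ := C * ((6 * (i : ℝ) + 2) * (inertiaConst L T * K)) with hQ₁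
    set Q₂ : ℝ := ((driftConst L T) ^ 2) ^ (i + 1 + 1) with hQ₂
    have hQ₁0 : 0 ≤ Q₁ := by positivity
    have hQ₂0 : 0 ≤ Q₂ := by positivity
    refine ⟨Real.exp (a * (L + 1) * T) * (((2 : ℝ) ^ 2) ^ (i + 1 + 1) + a * (Q₁ + Q₂) * T),
      by positivity, ?_⟩
    intro μ _ X G h p₀ c B N s H hc hB t ht
    have hB0 := H.B_nonneg
    have hBpow : (B ^ 2) ^ (i + 1 + 1) ≤ B ^ (i + 1 + 1) := by
      rw [← pow_mul]
      exact pow_le_pow_of_le_one hB0 hB (by omega)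
    have h0 : moment μ X (i + 1 + 1) 0 ≤ ((2 : ℝ) ^ 2) ^ (i + 1 + 1) * B ^ (i + 1 + 1) := by
      refine (H.moment_initial_le _).trans ?_
      rw [mul_pow 2 B 2, mul_pow]
      gcongr
    have hstep : ∀ r ∈ Ioo 0 T, 2 * (((i + 1 : ℕ) : ℝ) + 1) *
        (c * ∫ α, (‖rel μ X r α‖ ^ 2) ^ (i + 1) *
          ⟪rel μ X r α, ∫ α', kern (rel μ X r α - rel μ X r α') ∂μ⟫ ∂μ
        + ∫ α, (‖rel μ X r α‖ ^ 2) ^ (i + 1) * ⟪rel μ X r α, drift μ X G h r α⟫ ∂μ)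
        ≤ a * (L + 1) * moment μ X (i + 1 + 1) r + a * (Q₁ + Q₂) * B ^ (i + 1 + 1) := by
      intro r hr
      have hrI := Ioo_subset_Icc_self hr
      have h2 := H.abs_integral_inner_interaction_le hrI i
      have h5 := H.integral_pow_mul_inner_drift_le_moment (i + 1) hr
      set I₁ := ∫ α, (‖rel μ X r α‖ ^ 2) ^ (i + 1) *
        ⟪rel μ X r α, ∫ α', kern (rel μ X r α - rel μ X r α') ∂μ⟫ ∂μ
      have h4 : c * I₁ ≤ Q₁ * B ^ (i + 1 + 1) := by
        calc c * I₁ ≤ |c| * |I₁| := by rw [← abs_mul]; exact le_abs_self _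
          _ ≤ C * ((6 * (i : ℝ) + 2) * ((inertiaConst L T * B ^ 2) * (K * B ^ i))) := by
            refine mul_le_mul hc (h2.trans ?_) (abs_nonneg _) hC
            refine mul_le_mul_of_nonneg_left ?_ (by positivity)
            exact mul_le_mul (H.moment_one_le hrI) (hK μ X G h p₀ c B N s H hc hB r hrI)
              (moment_nonneg _ _) (by positivity)
          _ = _ := by rw [hQ₁]; ring
      have h7 : ((driftConst L T * B) ^ 2) ^ (i + 1 + 1) ≤ Q₂ * B ^ (i + 1 + 1) := by
        rw [mul_pow, mul_pow]
        exact mul_le_mul_of_nonneg_left hBpow hQ₂0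
      calc _ ≤ a * (Q₁ * B ^ (i + 1 + 1) + ((L + 1) * moment μ X (i + 1 + 1) r
              + Q₂ * B ^ (i + 1 + 1))) :=
            mul_le_mul_of_nonneg_left (add_le_add h4 (h5.trans (by linarith))) ha0
        _ = _ := by ring
    have := gronwall_of_ae_of_threshold (K := a * (L + 1)) (c := a * (Q₁ + Q₂) * B ^ (i + 1 + 1))
      (by positivity) (by positivity) (by positivity) (H.continuousOn_moment (i + 1 + 1))
      (fun r hr => (H.hasDerivAt_moment_split (i + 1) hr).2) (by
        filter_upwards [ae_restrict_mem measurableSet_Ioo] with r hr _ using hstep r hr) h0 ht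
    exact this.trans (le_of_eq (by ring))

/-! ### Particles far from the center -/

/-- The radial velocity generated by the vortex at distance at least `r` from its center.
The leading term of the kernel, linear in the position of the inducing particle, averages to zero;
what is left is bounded by the moment of inertia and by the effect of the particles beyond
distance `r / 2`. -/
lemma abs_inner_interaction_le (H : VortexFlow μ X G h p₀ L T c B N s) {t : ℝ} (ht : t ∈ Icc 0 T)
    {α : Λ} {r ρ : ℝ} (hr : 0 < r) (hρ : 0 < ρ) (hα : r ≤ ‖rel μ X t α‖) :
    |⟪rel μ X t α, ∫ α', kern (rel μ X t α - rel μ X t α') ∂μ⟫|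
      ≤ 10 * moment μ X 1 t / ‖rel μ X t α‖ ^ 2
        + ‖rel μ X t α‖ * (N * ρ ^ s + μ.real {α' | r / 2 < ‖rel μ X t α'‖} / ρ) := by
  set z := rel μ X t α with hz
  set S : Set Λ := {α' | r / 2 < ‖rel μ X t α'‖} with hS
  have hzm := H.measurable_rel ht
  have hSm : MeasurableSet S := measurableSet_lt measurable_const hzm.norm
  have hz0 : 0 < ‖z‖ := hr.trans_le hα
  have hdist : ∀ α', z - rel μ X t α' = X t α - X t α' := fun α' => by simp [hz, rel]
  have hk : Integrable (fun α' => kern (z - rel μ X t α')) μ := by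
    simp_rw [hdist]; exact H.integrable_kern ht _
  have hinv : Integrable (fun α' => ‖z - rel μ X t α'‖⁻¹) μ := by
    simp_rw [hdist]; exact H.integrable_inv_dist ht _
  have hp : Integrable (fun α' => ⟪z, perp (rel μ X t α')⟫ / ‖z‖ ^ 2) μ :=
    H.integrable_comp_rel ht (f := fun w => ⟪z, perp w⟫ / ‖z‖ ^ 2)
      (by have := continuous_perp; fun_prop)
  have hP : Integrable (fun α' => ‖rel μ X t α'‖ ^ 2) μ :=
    H.integrable_comp_rel ht (f := fun w => ‖w‖ ^ 2) (by fun_prop)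
  have e1 : ⟪z, ∫ α', kern (z - rel μ X t α') ∂μ⟫
      = ∫ α', (⟪z, kern (z - rel μ X t α')⟫ + ⟪z, perp (rel μ X t α')⟫ / ‖z‖ ^ 2) ∂μ := by
    rw [integral_add (hk.const_inner z) hp, integral_div, H.integral_inner_perp_eq_zero ht,
      integral_inner hk]
    simp
  have hpt : ∀ α', ‖⟪z, kern (z - rel μ X t α')⟫ + ⟪z, perp (rel μ X t α')⟫ / ‖z‖ ^ 2‖
      ≤ 10 / ‖z‖ ^ 2 * ‖rel μ X t α'‖ ^ 2
        + ‖z‖ * S.indicator (fun α' => ‖z - rel μ X t α'‖⁻¹) α' := by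
    intro α'
    set w := rel μ X t α'
    have hw0 : 0 ≤ ‖w‖ := norm_nonneg _
    have hzw : |⟪z, perp w⟫| ≤ ‖z‖ * ‖w‖ := by
      rw [← norm_perp w]; exact abs_real_inner_le_norm _ _
    rw [Real.norm_eq_abs]
    rcases le_or_gt ‖w‖ (‖z‖ / 2) with hle | hgt
    · refine le_add_of_le_of_nonneg ?_
        (mul_nonneg hz0.le (indicator_nonneg (fun _ _ => by positivity) _))
      have hd : ‖z‖ / 2 ≤ ‖z - w‖ := by linarith [norm_sub_norm_le z w]
      have hd0 : 0 < ‖z - w‖ := by linarith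
      have hD : ‖z - w‖ ^ 2 = ‖z‖ ^ 2 - 2 * ⟪z, w⟫ + ‖w‖ ^ 2 := norm_sub_sq_real z w
      have hin : |⟪z, w⟫| ≤ ‖z‖ * ‖w‖ := abs_real_inner_le_norm _ _
      rw [inner_kern_sub_left]
      have e : -(⟪z, perp w⟫ / ‖z - w‖ ^ 2) + ⟪z, perp w⟫ / ‖z‖ ^ 2
          = ⟪z, perp w⟫ * (‖z - w‖ ^ 2 - ‖z‖ ^ 2) / (‖z - w‖ ^ 2 * ‖z‖ ^ 2) := by
        field_simp; ring
      have hnum : |‖z - w‖ ^ 2 - ‖z‖ ^ 2| ≤ 5 / 2 * ‖z‖ * ‖w‖ := by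
        rw [hD, abs_le]
        have := abs_le.1 hin
        constructor <;> nlinarith
      have hden : ‖z‖ ^ 2 / 4 ≤ ‖z - w‖ ^ 2 := by nlinarith
      rw [e, abs_div, abs_mul, abs_of_pos (by positivity : 0 < ‖z - w‖ ^ 2 * ‖z‖ ^ 2)]
      calc _ ≤ (‖z‖ * ‖w‖) * (5 / 2 * ‖z‖ * ‖w‖) / (‖z‖ ^ 2 / 4 * ‖z‖ ^ 2) := by gcongr
        _ = _ := by field_simp; ring
    · have hmem : α' ∈ S := by
        change r / 2 < ‖w‖
        linarith
      rw [indicator_of_mem hmem]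
      have h1 : |⟪z, kern (z - w)⟫| ≤ ‖z‖ * ‖z - w‖⁻¹ := by
        rw [← norm_kern]; exact abs_real_inner_le_norm _ _
      have h2 : |⟪z, perp w⟫ / ‖z‖ ^ 2| ≤ 10 / ‖z‖ ^ 2 * ‖w‖ ^ 2 := by
        rw [abs_div, abs_of_pos (by positivity : 0 < ‖z‖ ^ 2), div_mul_eq_mul_div]
        gcongr
        nlinarith
      linarith [abs_add_le ⟪z, kern (z - w)⟫ (⟪z, perp w⟫ / ‖z‖ ^ 2)]
  have hbound := norm_integral_le_of_norm_le
    ((hP.const_mul (10 / ‖z‖ ^ 2)).add ((hinv.indicator hSm).const_mul ‖z‖))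
    (ae_of_all μ hpt)
  have hS2 : ∫ α', S.indicator (fun α' => ‖z - rel μ X t α'‖⁻¹) α' ∂μ
      ≤ N * ρ ^ s + μ.real S / ρ := by
    rw [integral_indicator hSm]
    simp_rw [hdist]
    exact H.setIntegral_inv_dist_le ht _ hSm hρ
  rw [e1, ← Real.norm_eq_abs]
  refine hbound.trans ?_
  simp only [Pi.add_apply]
  rw [integral_add (hP.const_mul _) ((hinv.indicator hSm).const_mul _), integral_const_mul,
    integral_const_mul]
  refine add_le_add (le_of_eq ?_) (mul_le_mul_of_nonneg_left hS2 hz0.le)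
  simp only [moment, pow_one]
  ring

/-- A quantitative bound of the distance from the center, in terms of the moment of inertia and of
the mass beyond distance `r / 2`. -/
lemma ae_sq_norm_rel_le (H : VortexFlow μ X G h p₀ L T c B N s) {r ρ C J E : ℝ} (hr : 0 < r)
    (hρ : 0 < ρ) (hBr : 2 * B ≤ r) (hc : |c| ≤ C) (hJ : ∀ t ∈ Icc 0 T, moment μ X 1 t ≤ J)
    (hE : ∀ t ∈ Icc 0 T, N * ρ ^ s + μ.real {α' | r / 2 < ‖rel μ X t α'‖} / ρ ≤ E) :
    ∀ᵐ α ∂μ, ∀ t ∈ Icc 0 T, ‖rel μ X t α‖ ^ 2 ≤ Real.exp ((2 * L + 2) * T) *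
      (r ^ 2 + (20 * C * J / r ^ 2 + C ^ 2 * E ^ 2 + (driftConst L T * B) ^ 2) * T) := by
  obtain ⟨K, hK⟩ := H.exists_rel_bound
  have h0T : (0 : ℝ) ∈ Icc 0 T := ⟨le_rfl, H.T_pos.le⟩
  have hC : 0 ≤ C := (abs_nonneg c).trans hc
  have hJ0 : 0 ≤ J := (moment_nonneg 1 0).trans (hJ 0 h0T)
  filter_upwards [hK, H.norm_rel_zero_le, H.ae_ae_norm_h_le] with α hα hα0 hαh t ht
  refine gronwall_of_ae_of_threshold (f := fun t => ‖rel μ X t α‖ ^ 2) (by positivity)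
    (by positivity) (sq_nonneg r) (hα.2.continuousOn.norm.pow 2)
    (fun t ht => (H.hasDerivAt_rel ht α).norm_sq) ?_ ?_ ht
  · filter_upwards [hαh, ae_restrict_mem measurableSet_Ioo] with t hht htm hrt
    have htI := Ioo_subset_Icc_self htm
    have hrz : r ≤ ‖rel μ X t α‖ := le_of_sq_le_sq hrt (norm_nonneg _)
    have h1 := H.abs_inner_interaction_le htI hr hρ hrz
    have h2 := (H.norm_drift_le htm hht).trans
      (add_le_add_right (H.drift_offset_le htI) (L * ‖rel μ X t α‖))
    set z := rel μ X t α
    set u := ∫ α', kern (z - rel μ X t α') ∂μ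
    set f := drift μ X G h t α
    set D := driftConst L T * B
    have hz0 : 0 ≤ ‖z‖ := norm_nonneg _
    have h3 : |⟪z, u⟫| ≤ 10 * J / r ^ 2 + ‖z‖ * E := by
      refine h1.trans (add_le_add ?_ (mul_le_mul_of_nonneg_left (hE t htI) hz0))
      have := hJ t htI
      gcongr
    have h4 : c * ⟪z, u⟫ ≤ C * (10 * J / r ^ 2 + ‖z‖ * E) := by
      calc c * ⟪z, u⟫ ≤ |c| * |⟪z, u⟫| := by rw [← abs_mul]; exact le_abs_self _
        _ ≤ _ := mul_le_mul hc h3 (abs_nonneg _) hC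
    have h5 : ⟪z, f⟫ ≤ ‖z‖ * (L * ‖z‖ + D) :=
      (real_inner_le_norm _ _).trans (mul_le_mul_of_nonneg_left h2 hz0)
    rw [inner_add_right, inner_smul_right]
    have h6 : C * (10 * J / r ^ 2) * 2 = 20 * C * J / r ^ 2 := by ring
    nlinarith [sq_nonneg (‖z‖ - C * E), sq_nonneg (‖z‖ - D)]
  · gcongr
    exact hα0.trans hBr

end VortexFlow

lemma eventually_const_mul_rpow_le (K : ℝ) {p θ : ℝ} (hp : 0 < p) (hθ : 0 < θ) :
    ∀ᶠ A in 𝓝[>] (0 : ℝ), K * A ^ p ≤ θ := by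
  have h1 : Tendsto (fun A : ℝ => K * A ^ p) (𝓝 0) (𝓝 (K * 0 ^ p)) :=
    ((Real.continuousAt_rpow_const 0 p (Or.inr hp.le)).tendsto).const_mul K
  rw [Real.zero_rpow hp.ne', mul_zero] at h1
  exact (h1.mono_left nhdsWithin_le_nhds).eventually (eventually_le_nhds hθ)

namespace VortexFlow

/-- Confinement: if the concentration parameter `N` is at most a negative power of the scale `A`,
then for small `A` the particles stay within distance `A ^ a / 2` of the center. A moment
of sufficiently high order makes the mass beyond distance `A ^ a` smaller than any prescribed
power of `A`, which outweighs `N`. -/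
lemma eventually_ae_norm_rel_le (Λ : Type*) [MeasurableSpace Λ] (L : ℝ≥0)
    {T C₀ C N₀ γ s a : ℝ} (hT : 0 < T) (hC₀ : 0 ≤ C₀) (hC : 0 < C) (hs : 0 < s)
    (ha0 : 0 ≤ a) (ha : a < 1 / 2) :
    ∀ᶠ A in 𝓝[>] (0 : ℝ), ∀ (μ : Measure Λ) [IsProbabilityMeasure μ] (X : ℝ → Λ → Plane)
      (G : ℝ → Plane → Plane) (h : ℝ → Λ → Plane) (p₀ : Plane) (c : ℝ),
      VortexFlow μ X G h p₀ L T c (C * A) (N₀ * A ^ (-γ)) s → |c| ≤ C₀ →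
      ∀ᵐ α ∂μ, ∀ t ∈ Icc 0 T, ‖rel μ X t α‖ ≤ A ^ a / 2 := by
  set q : ℝ := (1 + γ) / s with hq
  obtain ⟨k, hk⟩ : ∃ k : ℕ, q + 1 ≤ 2 * k * (1 - 2 * a) := by
    obtain ⟨k, hk⟩ := exists_nat_ge ((q + 1) / (2 * (1 - 2 * a)))
    refine ⟨k, ?_⟩
    rw [div_le_iff₀ (by linarith)] at hk
    linarith
  obtain ⟨K, hK0, hK⟩ := exists_moment_bound Λ L hT hC₀ k
  set e : ℝ := Real.exp ((2 * L + 2) * T) with he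
  -- the threshold radius is `κ A ^ a`, small enough to absorb the exponential growth `e`
  set κ : ℝ := Real.exp (-((L + 1) * T)) / 4 with hκ
  have hκ0 : 0 < κ := by positivity
  have heκ : e * κ ^ 2 = 1 / 16 := by
    rw [he, hκ, div_pow, ← Real.exp_nat_mul, mul_div_assoc', ← Real.exp_add]
    have : (2 * (L : ℝ) + 2) * T + ((2 : ℕ) : ℝ) * -((L + 1) * T) = 0 := by push_cast; ring
    rw [this, Real.exp_zero]; norm_num
  have hI0 : 0 ≤ inertiaConst L T := by unfold inertiaConst; positivity
  set K₁ : ℝ := K * C ^ (2 * k) * (((2 / κ) ^ 2) ^ (2 * k)) with hK₁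
  have hK₁0 : 0 ≤ K₁ := by positivity
  set K₂ : ℝ := 20 * C₀ * (inertiaConst L T * C ^ 2) / κ ^ 2 + C₀ ^ 2 * (N₀ + K₁) ^ 2
    + (driftConst L T * C) ^ 2 with hK₂
  have hK₂0 : 0 ≤ K₂ := by positivity
  filter_upwards [self_mem_nhdsWithin, eventually_const_mul_rpow_le 1 one_pos one_pos,
    eventually_const_mul_rpow_le C one_pos one_pos,
    eventually_const_mul_rpow_le (2 * C) (p := 1 - a) (by linarith) hκ0,
    eventually_const_mul_rpow_le (e * (K₂ * T)) (p := 2 - 4 * a) (θ := 3 / 16) (by linarith)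
      (by norm_num)] with A hA0 hA1 hCA hCA' hlast μ _ X G h p₀ c H hc
  replace hA0 : 0 < A := hA0
  rw [Real.rpow_one] at hA1 hCA
  rw [one_mul] at hA1
  set r : ℝ := κ * A ^ a with hr
  have hr0 : 0 < r := by positivity
  have hρ0 : 0 < A ^ q := by positivity
  have hmass : ∀ t ∈ Icc 0 T,
      μ.real {α' | r / 2 < ‖rel μ X t α'‖} ≤ K₁ * A ^ (2 * k * (1 - 2 * a)) := by
    intro t ht
    have h1 := mul_meas_ge_le_integral_of_nonneg (μ := μ)
      (f := fun α => (‖rel μ X t α‖ ^ 2) ^ (2 * k)) (ae_of_all _ fun α => by positivity)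
      (H.integrable_comp_rel ht (f := fun z => (‖z‖ ^ 2) ^ (2 * k)) (by fun_prop))
      (((r / 2) ^ 2) ^ (2 * k))
    have h2 : μ.real {α' | r / 2 < ‖rel μ X t α'‖}
        ≤ μ.real {α | ((r / 2) ^ 2) ^ (2 * k) ≤ (‖rel μ X t α‖ ^ 2) ^ (2 * k)} := by
      refine measureReal_mono fun α hα => ?_
      have : r / 2 < ‖rel μ X t α‖ := hα
      simp only [mem_ofPred_eq]
      gcongr
    have h3 := hK μ X G h p₀ c _ _ s H hc hCA t ht
    have h4 : ((r / 2) ^ 2) ^ (2 * k) * μ.real {α' | r / 2 < ‖rel μ X t α'‖}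
        ≤ K * (C * A) ^ (2 * k) :=
      (mul_le_mul_of_nonneg_left h2 (by positivity)).trans (h1.trans h3)
    rw [← le_div_iff₀' (by positivity)] at h4
    refine h4.trans (le_of_eq ?_)
    have h5 : A ^ (2 * k * (1 - 2 * a)) = A ^ (2 * k) / ((A ^ a) ^ 2) ^ (2 * k) := by
      rw [← pow_mul, ← Real.rpow_mul_natCast hA0.le, ← Real.rpow_natCast A (2 * k),
        ← Real.rpow_sub hA0]
      congr 1; push_cast; ring
    have h6 : ((r / 2) ^ 2) ^ (2 * k) = ((A ^ a) ^ 2) ^ (2 * k) / ((2 / κ) ^ 2) ^ (2 * k) := by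
      rw [← div_pow, hr]
      congr 1
      field_simp
    rw [h5, h6, hK₁, mul_pow]
    have h7 : 0 < ((2 / κ) ^ 2) ^ (2 * k) := by positivity
    have h8 : 0 < ((A ^ a) ^ 2) ^ (2 * k) := by positivity
    generalize ((2 / κ) ^ 2) ^ (2 * k) = y at *
    generalize ((A ^ a) ^ 2) ^ (2 * k) = x at *
    field_simp
  have hE : ∀ t ∈ Icc 0 T, N₀ * A ^ (-γ) * (A ^ q) ^ s
      + μ.real {α' | r / 2 < ‖rel μ X t α'‖} / A ^ q ≤ (N₀ + K₁) * A := by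
    intro t ht
    have h1 : A ^ (-γ) * (A ^ q) ^ s = A := by
      rw [← Real.rpow_mul hA0.le, ← Real.rpow_add hA0]
      have : -γ + q * s = 1 := by rw [hq]; field_simp; ring
      rw [this, Real.rpow_one]
    have h2 : μ.real {α' | r / 2 < ‖rel μ X t α'‖} / A ^ q ≤ K₁ * A := by
      rw [div_le_iff₀ hρ0]
      refine (hmass t ht).trans ?_
      rw [mul_assoc K₁]
      refine mul_le_mul_of_nonneg_left ?_ hK₁0
      nth_rewrite 2 [← Real.rpow_one A]
      rw [← Real.rpow_add hA0]
      exact Real.rpow_le_rpow_of_exponent_ge hA0 hA1 (by linarith)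
    rw [mul_assoc, h1, add_mul]
    linarith
  have hBr : 2 * (C * A) ≤ r := by
    have h1 : A ^ (1 - a) * A ^ a = A := by rw [← Real.rpow_add hA0]; simp
    calc 2 * (C * A) = 2 * C * A ^ (1 - a) * A ^ a := by rw [mul_assoc _ _ (A ^ a), h1]; ring
      _ ≤ κ * A ^ a := by gcongr
  have hmain := H.ae_sq_norm_rel_le hr0 hρ0 hBr hc (fun t ht => H.moment_one_le ht) hE
  filter_upwards [hmain] with α hα t ht
  have hAa : 0 < A ^ a := by positivity
  refine le_of_sq_le_sq ((hα t ht).trans ?_) (by positivity)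
  have hp1 : A ^ (2 - 4 * a) * (A ^ a) ^ 2 = A ^ 2 / (A ^ a) ^ 2 := by
    rw [eq_div_iff (by positivity), ← Real.rpow_mul_natCast hA0.le, ← Real.rpow_add hA0,
      ← Real.rpow_add hA0, ← Real.rpow_natCast A 2]
    congr 1; push_cast; ring
  have hAa1 : (A ^ a) ^ 2 ≤ 1 := pow_le_one₀ hAa.le (Real.rpow_le_one hA0.le hA1 ha0)
  have hA2 : A ^ 2 ≤ A ^ (2 - 4 * a) * (A ^ a) ^ 2 := by
    rw [hp1]
    exact le_div_self (sq_nonneg A) (by positivity) hAa1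
  have hbr : 20 * C₀ * (Real.exp ((4 * L + 1) * T) * (4 + 4 * T) * (C * A) ^ 2) / r ^ 2
      + C₀ ^ 2 * ((N₀ + K₁) * A) ^ 2 + (driftConst L T * (C * A)) ^ 2
      ≤ K₂ * (A ^ (2 - 4 * a) * (A ^ a) ^ 2) := by
    have h1 : 20 * C₀ * (Real.exp ((4 * L + 1) * T) * (4 + 4 * T) * (C * A) ^ 2) / r ^ 2
        = 20 * C₀ * (inertiaConst L T * C ^ 2) / κ ^ 2 * (A ^ (2 - 4 * a) * (A ^ a) ^ 2) := by
      rw [hp1, hr, inertiaConst]; field_simp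
    have h2 := mul_le_mul_of_nonneg_left hA2
      (by positivity : 0 ≤ C₀ ^ 2 * (N₀ + K₁) ^ 2 + (driftConst L T * C) ^ 2)
    rw [h1, hK₂]
    linarith
  calc _ ≤ e * ((κ * A ^ a) ^ 2 + K₂ * (A ^ (2 - 4 * a) * (A ^ a) ^ 2) * T) := by gcongr
    _ = (e * κ ^ 2 + e * (K₂ * T) * A ^ (2 - 4 * a)) * (A ^ a) ^ 2 := by ring
    _ ≤ (1 / 16 + 3 / 16) * (A ^ a) ^ 2 := by rw [heκ]; gcongr
    _ = _ := by ring

end VortexFlow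

/-! ### The kernel on small discs -/

lemma exists_eLpNorm_inv_norm_le {q : ℝ≥0∞} (hq1 : 1 ≤ q) (hq2 : q < 2) :
    ∃ D s : ℝ, 0 ≤ D ∧ 0 < s ∧ ∀ ρ : ℝ, 0 < ρ →
      eLpNorm ((Metric.ball (0 : Plane) ρ).indicator fun y => ‖y‖⁻¹) q volume
        ≤ ENNReal.ofReal (D * ρ ^ s) := by
  have hqtop : q ≠ ∞ := (hq2.trans (by simp)).ne
  have hq0 : q ≠ 0 := (zero_lt_one.trans_le hq1).ne'
  set r := q.toReal with hr
  have hr1 : 1 ≤ r := by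
    rw [hr, ← ENNReal.toReal_one]; exact ENNReal.toReal_mono hqtop hq1
  have hr2 : r < 2 := by
    have := ENNReal.toReal_strict_mono (by simp) hq2
    simpa using this
  have hr0 : 0 < r := by linarith
  set v : ℝ := volume.real (Metric.ball (0 : Plane) 1) with hv
  have hv0 : 0 ≤ v := measureReal_nonneg
  have h2r : 0 < 2 - r := by linarith
  refine ⟨(2 * v / (2 - r)) ^ (1 / r), (2 - r) * (1 / r), by positivity, by positivity,
    fun ρ hρ => ?_⟩
  set φ : ℝ → ℝ := (Iio ρ).indicator fun x => x ^ (-r) with hφ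
  have hpow : ∀ y : Plane,
      ‖(Metric.ball (0 : Plane) ρ).indicator (fun y => ‖y‖⁻¹) y‖ₑ ^ r
        = ENNReal.ofReal (φ ‖y‖) := by
    intro y
    by_cases hy : ‖y‖ < ρ
    · rw [indicator_of_mem (by simpa using hy), hφ, indicator_of_mem (by simpa using hy),
        Real.enorm_of_nonneg (by positivity), ENNReal.ofReal_rpow_of_nonneg (by positivity) hr0.le,
        Real.inv_rpow (norm_nonneg _), Real.rpow_neg (norm_nonneg _)]
    · rw [indicator_of_notMem (by simpa using hy), hφ, indicator_of_notMem (by simpa using hy)]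
      simp [hr0]
  -- in polar coordinates the radial density is `y ^ (1 - r)` on `(0, ρ)`
  have hrad : EqOn (fun y : ℝ => y ^ (Module.finrank ℝ Plane - 1) • φ y)
      ((Ioo 0 ρ).indicator fun y => y ^ (1 - r)) (Ioi 0) := by
    intro y hy
    have hy0 : 0 < y := hy
    simp only [finrank_euclideanSpace, Fintype.card_fin, Nat.add_one_sub_one, pow_one, smul_eq_mul]
    by_cases hyρ : y < ρ
    · rw [hφ, indicator_of_mem (by simpa using hyρ), indicator_of_mem (mem_Ioo.2 ⟨hy0, hyρ⟩),
        sub_eq_add_neg, Real.rpow_add hy0, Real.rpow_one]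
    · rw [hφ, indicator_of_notMem (by simpa using hyρ), 
        indicator_of_notMem (fun h => hyρ (mem_Ioo.1 h).2), mul_zero]
  have hIoo : IntegrableOn (fun y : ℝ => y ^ (1 - r)) (Ioo 0 ρ) :=
    (intervalIntegral.integrableOn_Ioo_rpow_iff hρ).2 (by linarith)
  have hint : Integrable (fun y : Plane => φ ‖y‖) volume := by
    rw [integrable_fun_norm_addHaar, integrableOn_congr_fun hrad measurableSet_Ioi]
    exact (integrable_indicator_iff measurableSet_Ioo |>.2 hIoo).integrableOn
  have hφ0 : ∀ y : Plane, 0 ≤ φ ‖y‖ := fun y =>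
    indicator_apply_nonneg fun _ => Real.rpow_nonneg (norm_nonneg _) _
  have hval : ∫ y : Plane, φ ‖y‖ = 2 * v / (2 - r) * ρ ^ (2 - r) := by
    rw [integral_fun_norm_addHaar, setIntegral_congr_fun measurableSet_Ioi hrad,
      setIntegral_indicator measurableSet_Ioo, inter_eq_right.2 Ioo_subset_Ioi_self,
      ← integral_Ioc_eq_integral_Ioo, ← intervalIntegral.integral_of_le hρ.le,
      integral_rpow (Or.inl (by linarith)), Real.zero_rpow (by linarith)]
    have e : 1 - r + 1 = 2 - r := by ring
    simp only [finrank_euclideanSpace, Fintype.card_fin, e, sub_zero, nsmul_eq_mul, smul_eq_mul,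
      Nat.cast_ofNat, ← hv]
    ring
  rw [eLpNorm_eq_lintegral_rpow_enorm_toReal hq0 hqtop]
  simp_rw [← hr, hpow]
  rw [← ofReal_integral_eq_lintegral_ofReal hint (ae_of_all _ hφ0), hval,
    ENNReal.ofReal_rpow_of_nonneg (by positivity) (by positivity),
    Real.mul_rpow (by positivity) (by positivity), ← Real.rpow_mul hρ.le]

/-- A density in `Lᵖ` with `p > 2`, transported by measure-preserving maps, does not concentrate:
its potential with kernel `1 / |x|`, restricted to discs of radius `ρ`, is at most a power
of `ρ`. -/
lemma exists_lintegral_near_le {p : ℝ≥0∞} (hp : 2 < p) :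
    ∃ D s : ℝ, 0 ≤ D ∧ 0 < s ∧ ∀ (f : Plane → ℝ) (Φ : Plane → Plane) (Y : ℝ),
      AEStronglyMeasurable f volume → MeasurePreserving Φ volume volume → 0 ≤ Y →
      eLpNorm f p volume ≤ ENNReal.ofReal Y → ∀ (x : Plane) (ρ : ℝ), 0 < ρ →
      ∫⁻ α in {α | ‖x - Φ α‖ < ρ}, ‖f α‖ₑ * ENNReal.ofReal ‖x - Φ α‖⁻¹
        ≤ ENNReal.ofReal (Y * D * ρ ^ s) := by
  have hp1 : 1 ≤ p := (by norm_num : (1 : ℝ≥0∞) ≤ 2).trans hp.le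
  set q := p.conjExponent with hq
  have hpq : p.HolderConjugate q := ENNReal.HolderConjugate.conjExponent hp1
  have hsum : p⁻¹ + q⁻¹ = 1 := ENNReal.HolderConjugate.inv_add_inv_eq_one p q
  have hp2 : p⁻¹ < 2⁻¹ := ENNReal.inv_lt_inv.2 hp
  have hq1 : 1 ≤ q := by
    rw [← ENNReal.inv_le_inv, inv_one, ← hsum]; exact le_add_self
  have hq2 : q < 2 := by
    rw [← ENNReal.inv_lt_inv]
    by_contra! hle
    have : p⁻¹ + q⁻¹ < 2⁻¹ + 2⁻¹ := 
      ENNReal.add_lt_add_of_lt_of_le (by simp [(zero_lt_one.trans_le hq1).ne']) hp2 hle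
    rw [hsum, ENNReal.inv_two_add_inv_two] at this
    exact lt_irrefl _ this
  obtain ⟨D, s, hD, hs, hDs⟩ := exists_eLpNorm_inv_norm_le hq1 hq2
  refine ⟨D, s, hD, hs, fun f Φ Y hf hΦ hY hfY x ρ hρ => ?_⟩
  set g : Plane → ℝ := (Metric.ball (0 : Plane) ρ).indicator fun y => ‖y‖⁻¹ with hg
  have hgm : Measurable g := Measurable.indicator (by fun_prop) Metric.isOpen_ball.measurableSet
  have hmp : MeasurePreserving (fun α => x - Φ α) volume volume :=
    (Measure.measurePreserving_sub_left volume x).comp hΦ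
  have hS : MeasurableSet {α | ‖x - Φ α‖ < ρ} :=
    measurableSet_lt hmp.measurable.norm measurable_const
  have h1 : ∫⁻ α in {α | ‖x - Φ α‖ < ρ}, ‖f α‖ₑ * ENNReal.ofReal ‖x - Φ α‖⁻¹
      = eLpNorm (f • (g ∘ fun α => x - Φ α)) 1 volume := by
    rw [eLpNorm_one_eq_lintegral_enorm, ← lintegral_indicator hS]
    congr 1
    ext α
    rw [Pi.smul_apply', smul_eq_mul, enorm_mul, Function.comp_apply, hg]
    by_cases hα : ‖x - Φ α‖ < ρ
    · rw [indicator_of_mem (by simpa using hα), indicator_of_mem (by simpa using hα),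
        Real.enorm_of_nonneg (by positivity : (0 : ℝ) ≤ ‖x - Φ α‖⁻¹)]
    · rw [indicator_of_notMem (by simpa using hα), indicator_of_notMem (by simpa using hα)]
      simp
  rw [h1]
  calc _ ≤ eLpNorm f p volume * eLpNorm (g ∘ fun α => x - Φ α) q volume :=
        eLpNorm_smul_le_mul_eLpNorm (hgm.comp hmp.measurable).aestronglyMeasurable hf
    _ ≤ ENNReal.ofReal Y * ENNReal.ofReal (D * ρ ^ s) := by
        rw [eLpNorm_comp_measurePreserving hgm.aestronglyMeasurable hmp]
        exact mul_le_mul' hfY (hDs ρ hρ)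
    _ = _ := by rw [← ENNReal.ofReal_mul hY, mul_assoc]

/-! ### From the transported vorticity to the Lagrangian flow -/

lemma Icc_subset_lifespan {Tstar : EReal} {T : ℝ} (hT : (T : EReal) < Tstar) :
    Icc 0 T ⊆ lifespan Tstar := fun _ ht =>
  ⟨ht.1, (EReal.coe_le_coe_iff.2 ht.2).trans_lt hT⟩

lemma zero_mem_lifespan {Tstar : EReal} (hT : 0 < Tstar) : (0 : ℝ) ∈ lifespan Tstar :=
  ⟨le_rfl, by simpa using hT⟩

lemma ae_eq_zero_of_notMem_essSupport (f : Plane → ℝ) :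
    ∀ᵐ x ∂(volume : Measure Plane), x ∉ essSupport f → f x = 0 := by
  have h : volume {x | x ∉ essSupport f ∧ f x ≠ 0} = 0 := by
    refine measure_null_of_locally_null _ fun x hx => ?_
    have hx1 : ¬ ∀ U ∈ 𝓝 x, ¬ (∀ᵐ y ∂(volume.restrict U), f y = 0) := hx.1
    push Not at hx1
    obtain ⟨U, hU, hfU⟩ := hx1
    obtain ⟨V, hVU, hVo, hxV⟩ := mem_nhds_iff.1 hU
    refine ⟨_ ∩ V, inter_mem_nhdsWithin _ (hVo.mem_nhds hxV), ?_⟩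
    have h1 : ∀ᵐ y ∂(volume.restrict V), f y = 0 :=
      ae_mono (Measure.restrict_mono hVU le_rfl) hfU
    rw [ae_restrict_iff' hVo.measurableSet] at h1
    refine measure_mono_null (fun y hy => ?_) h1
    exact fun h2 => hy.1.2 (h2 hy.2)
  rw [ae_iff]
  simpa using h

/-- The vorticity as a probability measure on particle labels: the normalised absolute value of
the initial vorticity. -/
noncomputable def labelMeasure (w : Plane → ℝ) : Measure Plane :=
  ENNReal.ofReal |∫ x, w x|⁻¹ • volume.withDensity fun x => ‖w x‖ₑ

lemma labelMeasure_absolutelyContinuous (w : Plane → ℝ) : labelMeasure w ≪ volume :=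
  (Measure.smul_absolutelyContinuous).trans (withDensity_absolutelyContinuous _ _)

section

variable {w : Plane → ℝ}

lemma ae_labelMeasure_iff (hw : Integrable w volume) (h0 : ∫ x, w x ≠ 0) {P : Plane → Prop} :
    (∀ᵐ x ∂(labelMeasure w), P x) ↔ ∀ᵐ x ∂(volume : Measure Plane), w x ≠ 0 → P x := by
  rw [labelMeasure, Measure.ae_ennreal_smul_measure_iff (by simpa using h0),
    ae_withDensity_iff' hw.aestronglyMeasurable.enorm]
  simp

lemma integral_abs_eq (hsign : (∀ᵐ x ∂(volume : Measure Plane), 0 ≤ w x) ∨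
    (∀ᵐ x ∂(volume : Measure Plane), w x ≤ 0)) :
    ∫ x, |w x| = |∫ x, w x| := by
  rcases hsign with h | h
  · rw [abs_of_nonneg (integral_nonneg_of_ae h)]
    exact integral_congr_ae (h.mono fun x hx => abs_of_nonneg hx)
  · rw [abs_of_nonpos (integral_nonpos_of_ae h), ← integral_neg]
    exact integral_congr_ae (h.mono fun x hx => abs_of_nonpos hx)

lemma isProbabilityMeasure_labelMeasure (hw : Integrable w volume) (h0 : ∫ x, w x ≠ 0)
    (hsign : (∀ᵐ x ∂(volume : Measure Plane), 0 ≤ w x) ∨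
      (∀ᵐ x ∂(volume : Measure Plane), w x ≤ 0)) :
    IsProbabilityMeasure (labelMeasure w) := by
  refine ⟨?_⟩
  have h1 : ∫⁻ x, ‖w x‖ₑ = ENNReal.ofReal |∫ x, w x| := by
    rw [← integral_abs_eq hsign, ← ofReal_integral_norm_eq_lintegral_enorm hw]
    rfl
  rw [labelMeasure, Measure.smul_apply, withDensity_apply _ MeasurableSet.univ, setLIntegral_univ,
    h1, smul_eq_mul, ← ENNReal.ofReal_mul (by positivity), inv_mul_cancel₀ (by simpa using h0),
    ENNReal.ofReal_one]

/-- As `w` has a sign, integrating against `w` is integrating against the label measure, up to the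
signed total mass. -/
lemma integral_smul_eq_labelMeasure {E : Type*} [NormedAddCommGroup E] [NormedSpace ℝ E]
    (hw : Integrable w volume) (h0 : ∫ x, w x ≠ 0)
    (hsign : (∀ᵐ x ∂(volume : Measure Plane), 0 ≤ w x) ∨
      (∀ᵐ x ∂(volume : Measure Plane), w x ≤ 0)) (g : Plane → E) :
    ∫ x, w x • g x = (∫ x, w x) • ∫ x, g x ∂(labelMeasure w) := by
  rw [labelMeasure, integral_smul_measure,
    integral_withDensity_eq_integral_toReal_smul₀ hw.aestronglyMeasurable.enorm
      (ae_of_all _ fun x => enorm_lt_top), ENNReal.toReal_ofReal (by positivity)]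
  simp only [toReal_enorm, Real.norm_eq_abs]
  rw [smul_smul]
  rcases hsign with h | h
  · rw [abs_of_nonneg (integral_nonneg_of_ae h), mul_inv_cancel₀ h0, one_smul]
    exact integral_congr_ae (h.mono fun x hx => by simp only [abs_of_nonneg (show 0 ≤ w x from hx)])
  · rw [abs_of_nonpos (integral_nonpos_of_ae h), inv_neg, mul_neg, mul_inv_cancel₀ h0, neg_smul,
      one_smul, ← integral_neg]
    exact integral_congr_ae (h.mono fun x hx => by
      simp only [abs_of_nonpos (show w x ≤ 0 from hx), neg_smul, neg_neg])

end

lemma MeasureTheory.MeasurePreserving.integral_comp_eq {S S' E : Type*} [MeasurableSpace S]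
    [MeasurableSpace S'] {μ : Measure S} {ν : Measure S'} [NormedAddCommGroup E] [NormedSpace ℝ E]
    {Φ : S → S'} (hΦ : MeasurePreserving Φ μ ν) {f : S' → E} (hf : AEStronglyMeasurable f ν) :
    ∫ α, f (Φ α) ∂μ = ∫ y, f y ∂ν := by
  rw [← integral_map hΦ.aemeasurable (by rwa [hΦ.map_eq]), hΦ.map_eq]

namespace IsTransportedVortex

variable {Tstar : EReal} {ω : ℝ → Plane → ℝ} {F₁ F₂ : ℝ → Plane → Plane}
  {X : ℝ → Plane → Plane}

lemma integrable (H : IsTransportedVortex Tstar ω F₁ F₂ X) {t : ℝ} (ht : t ∈ lifespan Tstar) :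
    Integrable (ω t) volume := memLp_one_iff_integrable.1 (H.memLp_one t ht)

lemma integral_smul_eq (H : IsTransportedVortex Tstar ω F₁ F₂ X) (hT : 0 < Tstar)
    (h0 : totalVorticity ω ≠ 0)
    (hsign : (∀ᵐ x ∂(volume : Measure Plane), 0 ≤ ω 0 x) ∨
      (∀ᵐ x ∂(volume : Measure Plane), ω 0 x ≤ 0)) {t : ℝ} (ht : t ∈ lifespan Tstar)
    {g : Plane → Plane} (hg : Measurable g) :
    ∫ y, ω t y • g y = totalVorticity ω • ∫ α, g (X t α) ∂(labelMeasure (ω 0)) := by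
  rw [← (H.measurePreserving t ht).integral_comp_eq
    (f := fun y => ω t y • g y)
    ((H.integrable ht).aestronglyMeasurable.smul hg.aestronglyMeasurable), totalVorticity,
    ← integral_smul_eq_labelMeasure (H.integrable (zero_mem_lifespan hT)) h0 hsign]
  exact integral_congr_ae ((H.transport t ht).mono fun α hα => by simp only [hα])

lemma biotSavart_eq (H : IsTransportedVortex Tstar ω F₁ F₂ X) (hT : 0 < Tstar)
    (h0 : totalVorticity ω ≠ 0)
    (hsign : (∀ᵐ x ∂(volume : Measure Plane), 0 ≤ ω 0 x) ∨
      (∀ᵐ x ∂(volume : Measure Plane), ω 0 x ≤ 0)) {t : ℝ} (ht : t ∈ lifespan Tstar) (x : Plane) :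
    biotSavart (ω t) x = (totalVorticity ω / (2 * Real.pi)) •
      ∫ α, kern (x - X t α) ∂(labelMeasure (ω 0)) := by
  rw [biotSavart, one_div, div_eq_inv_mul, ← smul_smul,
    ← H.integral_smul_eq hT h0 hsign ht (g := fun y => kern (x - y))
      (measurable_kern.comp (measurable_const.sub measurable_id))]
  simp only [kern, smul_smul, div_eq_mul_inv]

lemma vorticityCenter_eq (H : IsTransportedVortex Tstar ω F₁ F₂ X) (hT : 0 < Tstar)
    (h0 : totalVorticity ω ≠ 0)
    (hsign : (∀ᵐ x ∂(volume : Measure Plane), 0 ≤ ω 0 x) ∨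
      (∀ᵐ x ∂(volume : Measure Plane), ω 0 x ≤ 0)) {t : ℝ} (ht : t ∈ lifespan Tstar) :
    vorticityCenter ω t = VortexFlow.center (labelMeasure (ω 0)) X t := by
  rw [vorticityCenter, H.integral_smul_eq hT h0 hsign ht (g := fun y => y) measurable_id,
    smul_smul, inv_mul_cancel₀ h0, one_smul, VortexFlow.center]

/-- For almost every particle, the perturbation is bounded along the trajectory at almost
every time. -/
lemma ae_ae_norm_le (H : IsTransportedVortex Tstar ω F₁ F₂ X) {T B : ℝ}
    (hT : (T : EReal) < Tstar)
    (hF₂meas : Measurable (fun z : lifespan Tstar × Plane => F₂ z.1 z.2))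
    (hF₂ : ∀ t ∈ Icc 0 T, ∀ᵐ α ∂(volume : Measure Plane), ‖F₂ t (X t α)‖ ≤ B) :
    ∀ᵐ α ∂(volume : Measure Plane), ∀ᵐ t ∂(volume.restrict (Ioo 0 T)), ‖F₂ t (X t α)‖ ≤ B := by
  have hsub := Icc_subset_lifespan hT
  set ν : Measure (Icc 0 T) := Measure.comap Subtype.val volume with hν
  have : IsFiniteMeasure ν := ⟨by
    rw [hν, (MeasurableEmbedding.subtype_coe measurableSet_Icc).comap_apply, image_univ,
      Subtype.range_coe]
    exact measure_Icc_lt_top⟩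
  have hXm : Measurable (Function.uncurry fun (t : Icc 0 T) α => X t α) :=
    measurable_uncurry_of_continuous_of_measurable
      (fun α => continuousOn_iff_continuous_domRestrict.1 fun t ht =>
        (((H.trajectory α).2 t (hsub ht)).continuousWithinAt.mono hsub))
      (fun t => (H.measurePreserving t (hsub t.2)).measurable)
  have hFm : Measurable fun z : Icc 0 T × Plane => F₂ z.1 (X z.1 z.2) :=
    hF₂meas.comp (((measurable_inclusion hsub).comp measurable_fst).prodMk hXm)
  have hS : MeasurableSet {z : Icc 0 T × Plane | ‖F₂ z.1 (X z.1 z.2)‖ ≤ B} :=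
    measurableSet_le hFm.norm measurable_const
  have h1 := (Measure.ae_ae_comm (μ := ν) (ν := (volume : Measure Plane)) hS).1
    (ae_of_all _ fun t => hF₂ t t.2)
  filter_upwards [h1] with α hα
  exact ae_mono (Measure.restrict_mono Ioo_subset_Icc_self le_rfl)
    ((ae_restrict_iff_subtype measurableSet_Icc).2 hα)

/-- The particle trajectories of a concentrated transported vorticity, with the initial vorticity
as mass distribution. -/
lemma vortexFlow (H : IsTransportedVortex Tstar ω F₁ F₂ X) (hTstar : 0 < Tstar)
    {p : ℝ≥0∞} {D s : ℝ} (hD : 0 ≤ D)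
    (hnear : ∀ (f : Plane → ℝ) (Φ : Plane → Plane) (Y : ℝ),
      AEStronglyMeasurable f volume → MeasurePreserving Φ volume volume → 0 ≤ Y →
      eLpNorm f p volume ≤ ENNReal.ofReal Y → ∀ (x : Plane) (ρ : ℝ), 0 < ρ →
      ∫⁻ α in {α | ‖x - Φ α‖ < ρ}, ‖f α‖ₑ * ENNReal.ofReal ‖x - Φ α‖⁻¹
        ≤ ENNReal.ofReal (Y * D * ρ ^ s))
    {T B N ε Y m : ℝ} {p₀ : Plane} {L : ℝ≥0} (hT0 : 0 < T) (hT : (T : EReal) < Tstar)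
    (hF₂meas : Measurable (fun z : lifespan Tstar × Plane => F₂ z.1 z.2))
    (hF₁ : ∀ t ∈ lifespan Tstar, LipschitzWith L (F₁ t))
    (hF₂ : ∀ t ∈ lifespan Tstar, eLpNorm (F₂ t) ∞ volume ≤ ENNReal.ofReal B) (hB : 0 ≤ B)
    (hεB : ε ≤ B) (hsign : (∀ᵐ x ∂(volume : Measure Plane), 0 ≤ ω 0 x) ∨
      (∀ᵐ x ∂(volume : Measure Plane), ω 0 x ≤ 0))
    (hsupp : essSupport (ω 0) ⊆ Metric.ball p₀ ε) (hm : 0 < m) (hmΩ : m ≤ |totalVorticity ω|)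
    (hY : 0 ≤ Y) (hnorm : eLpNorm (ω 0) p volume ≤ ENNReal.ofReal Y) (hN : N = D / m * Y) :
    VortexFlow (labelMeasure (ω 0)) X F₁ (fun t α => F₂ t (X t α)) p₀ L T
      (totalVorticity ω / (2 * Real.pi)) B N s := by
  have hsub := Icc_subset_lifespan hT
  have hw := H.integrable (zero_mem_lifespan hTstar)
  have h0 : totalVorticity ω ≠ 0 := abs_pos.1 (hm.trans_le hmΩ)
  have hbd : ∀ t ∈ Icc 0 T, ∀ᵐ α ∂(volume : Measure Plane), ‖F₂ t (X t α)‖ ≤ B := by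
    intro t ht
    have h1 : ∀ᵐ y ∂(volume : Measure Plane), ‖F₂ t y‖ ≤ B := by
      have h2 := hF₂ t (hsub ht)
      rw [eLpNorm_exponent_top] at h2
      filter_upwards [ae_le_eLpNormEssSup (f := F₂ t) (μ := volume)] with y hy
      have h3 := hy.trans h2
      rwa [← ofReal_norm, ENNReal.ofReal_le_ofReal_iff hB] at h3
    exact (H.measurePreserving t (hsub ht)).quasiMeasurePreserving.ae h1
  have hac := labelMeasure_absolutelyContinuous (ω 0)
  refine ⟨by rw [hN]; positivity, hB, hT0,
    fun t ht => (H.measurePreserving t (hsub ht)).measurable,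
    fun α t ht => ((H.trajectory α).2 t (hsub ht)).continuousWithinAt.mono hsub,
    fun α t ht => ?_, fun t ht => hF₁ t (hsub (Ioo_subset_Icc_self ht)), fun t ht => ?_,
    fun t ht => hac.ae_le (hbd t (Ioo_subset_Icc_self ht)),
    hac.ae_le (H.ae_ae_norm_le hT hF₂meas hbd), fun t ht x ρ hρ => ?_, ?_⟩
  · have htl := hsub (Ioo_subset_Icc_self ht)
    have h1 := ((H.trajectory α).2 t htl).hasDerivAt
      (mem_of_superset (Ioo_mem_nhds ht.1 ht.2) (Ioo_subset_Icc_self.trans hsub))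
    refine h1.congr_deriv ?_
    rw [totalVelocity, H.biotSavart_eq hTstar h0 hsign htl, add_assoc]
  · have htl := hsub (Ioo_subset_Icc_self ht)
    exact hF₂meas.comp ((measurable_const (a := (⟨t, htl⟩ : lifespan Tstar))).prodMk
      (H.measurePreserving t htl).measurable)
  · have hX := H.measurePreserving t (hsub ht)
    have hXm := hX.measurable
    have hS : MeasurableSet {α | ‖x - X t α‖ < ρ} :=
      measurableSet_lt (by fun_prop) measurable_const
    have h1 := hnear (ω 0) (X t) Y hw.aestronglyMeasurable hX hY hnorm x ρ hρ
    rw [labelMeasure, Measure.restrict_smul, lintegral_smul_measure, restrict_withDensity hS,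
      lintegral_withDensity_eq_lintegral_mul₀ hw.aestronglyMeasurable.enorm.restrict
        (by fun_prop)]
    have hMm : |∫ x, ω 0 x|⁻¹ ≤ m⁻¹ := inv_anti₀ hm hmΩ
    calc _ ≤ ENNReal.ofReal m⁻¹ * ENNReal.ofReal (Y * D * ρ ^ s) :=
          mul_le_mul' (ENNReal.ofReal_le_ofReal hMm) h1
      _ = _ := by
        rw [← ENNReal.ofReal_mul (by positivity), hN]
        congr 1; field_simp
  · rw [ae_labelMeasure_iff hw h0]
    filter_upwards [ae_eq_zero_of_notMem_essSupport (ω 0)] with α hα hne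
    rw [(H.trajectory α).1]
    have h1 : α ∈ Metric.ball p₀ ε := hsupp (by_contra fun h => hne (hα h))
    rw [Metric.mem_ball, dist_eq_norm] at h1
    linarith

lemma essSupport_subset_ball (H : IsTransportedVortex Tstar ω F₁ F₂ X) (hT : 0 < Tstar)
    (h0 : totalVorticity ω ≠ 0) {t r R : ℝ} (ht : t ∈ lifespan Tstar) (hrR : r < R) {x₀ : Plane}
    (hX : ∀ᵐ α ∂(labelMeasure (ω 0)), ‖X t α - x₀‖ ≤ r) :
    essSupport (ω t) ⊆ Metric.ball x₀ R := by
  intro x hx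
  by_contra hxR
  have hmem : (Metric.closedBall x₀ r)ᶜ ∈ 𝓝 x := by
    refine Metric.isClosed_closedBall.isOpen_compl.mem_nhds fun h => hxR ?_
    exact Metric.closedBall_subset_ball hrR h
  refine hx _ hmem ?_
  rw [ae_restrict_iff' Metric.isClosed_closedBall.measurableSet.compl]
  have hmp := H.measurePreserving t ht
  -- `ω t` is measurable only up to null sets
  have hnull : NullMeasurableSet {y | ¬ (y ∈ (Metric.closedBall x₀ r)ᶜ → ω t y = 0)} volume := by
    have e : {y | ¬ (y ∈ (Metric.closedBall x₀ r)ᶜ → ω t y = 0)}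
        = (Metric.closedBall x₀ r)ᶜ ∩ (ω t ⁻¹' {0})ᶜ := by
      ext y; simp
    rw [e]
    exact Metric.isClosed_closedBall.measurableSet.compl.nullMeasurableSet.inter
      ((H.integrable ht).aestronglyMeasurable.aemeasurable.nullMeasurable
        (measurableSet_singleton 0)).compl
  rw [ae_iff, ← hmp.measure_preimage hnull]
  have h1 := (ae_labelMeasure_iff (H.integrable (zero_mem_lifespan hT)) h0).1 hX
  have h2 : ∀ᵐ α ∂(volume : Measure Plane),
      X t α ∈ (Metric.closedBall x₀ r)ᶜ → ω t (X t α) = 0 := by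
    filter_upwards [h1, H.transport t ht] with α hα htr hmemα
    rw [htr]
    by_contra hne
    exact hmemα (by simpa [dist_eq_norm] using hα hne)
  exact ae_iff.1 h2

end IsTransportedVortex

/-! ### Confinement of the transported vorticity -/

theorem mainTheorem4
    -- the families, indexed by the parameter `ε ∈ (0, ε₁)`, with time in `[0, T*)`
    (Tstar : EReal) (hTstar : 0 < Tstar) (ε₁ : ℝ) (hε₁ : 0 < ε₁)
    (ω : ℝ → ℝ → Plane → ℝ) (F₁ F₂ : ℝ → ℝ → Plane → Plane) (X : ℝ → ℝ → Plane → Plane)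
    (A : ℝ → ℝ) (p₀ : Plane) (Ω : ℝ) (L : ℝ≥0) (C γ : ℝ) (p₁ : ℝ≥0∞)
    (hΩ : Ω ≠ 0) (hC : 0 < C) (hγ : 0 < γ) (hp₁ : 2 < p₁)
    -- the background fields
    (hF₁meas : ∀ ε ∈ Set.Ioo 0 ε₁,
      Measurable (fun z : lifespan Tstar × Plane => F₁ ε z.1 z.2))
    (hF₂meas : ∀ ε ∈ Set.Ioo 0 ε₁,
      Measurable (fun z : lifespan Tstar × Plane => F₂ ε z.1 z.2))
    (hF₁ : ∀ ε ∈ Set.Ioo 0 ε₁, ∀ t ∈ lifespan Tstar, LipschitzWith L (F₁ ε t))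
    (hF₂ : ∀ ε ∈ Set.Ioo 0 ε₁, ∀ t ∈ lifespan Tstar,
      eLpNorm (F₂ ε t) ∞ volume ≤ ENNReal.ofReal (C * A ε))
    -- the scale `A`
    (hεA : ∀ ε ∈ Set.Ioo 0 ε₁, ε ≤ C * A ε)
    (hA : Tendsto A (𝓝[>] 0) (𝓝 0))
    -- the vorticity and its transport
    (hω : ∀ ε ∈ Set.Ioo 0 ε₁, IsTransportedVortex Tstar (ω ε) (F₁ ε) (F₂ ε) (X ε))
    -- the initial vorticity
    (hsign : ∀ ε ∈ Set.Ioo 0 ε₁,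
      (∀ᵐ x ∂(volume : Measure Plane), 0 ≤ ω ε 0 x) ∨
      (∀ᵐ x ∂(volume : Measure Plane), ω ε 0 x ≤ 0))
    (hsupp : ∀ ε ∈ Set.Ioo 0 ε₁, essSupport (ω ε 0) ⊆ Metric.ball p₀ ε)
    (hmass : Tendsto (fun ε => totalVorticity (ω ε)) (𝓝[>] 0) (𝓝 Ω))
    (hnorm : ∀ ε ∈ Set.Ioo 0 ε₁,
      eLpNorm (ω ε 0) p₁ volume ≤ ENNReal.ofReal (A ε ^ (-γ))) :
    ∀ T : ℝ, (T : EReal) < Tstar → ∀ a : ℝ, a < 1 / 2 →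
      ∃ ε₀ ∈ Set.Ioo 0 ε₁, ∀ ε : ℝ, 0 < ε → ε ≤ ε₀ → ∀ t ∈ Set.Icc 0 T,
        essSupport (ω ε t) ⊆ Metric.ball (vorticityCenter (ω ε) t) (A ε ^ a) := by
  intro T hT a ha
  -- work on a slightly longer interval of positive length, on which derivatives are two-sided
  obtain ⟨T', hTT', hT'⟩ : ∃ T' : ℝ, max (T : EReal) 0 < T' ∧ (T' : EReal) < Tstar :=
    EReal.lt_iff_exists_real_btwn.1 (max_lt hT hTstar)
  have hT'0 : 0 < T' := by exact_mod_cast (le_max_right _ _).trans_lt hTT'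
  have hT'T : T < T' := by exact_mod_cast (le_max_left _ _).trans_lt hTT'
  obtain ⟨D, s, hD, hs, hnear⟩ := exists_lintegral_near_le hp₁
  -- a negative exponent `a` may be replaced by `0`
  set b : ℝ := max a 0 with hb
  have hΩ' : 0 < |Ω| := abs_pos.2 hΩ
  have hm : 0 < |Ω| / 2 := by positivity
  have hconf := VortexFlow.eventually_ae_norm_rel_le (γ := γ) (N₀ := D / (|Ω| / 2)) Plane L hT'0
    (by positivity : 0 ≤ 2 * |Ω|) hC hs (le_max_right a 0) (max_lt ha (by norm_num))
  have hApos : ∀ ε ∈ Ioo 0 ε₁, 0 < A ε := fun ε hε =>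
    (mul_pos_iff_of_pos_left hC).1 (hε.1.trans_le (hεA ε hε))
  have hIoo : Ioo 0 ε₁ ∈ 𝓝[>] (0 : ℝ) := Ioo_mem_nhdsGT hε₁
  have hA' : Tendsto A (𝓝[>] 0) (𝓝[>] 0) := tendsto_nhdsWithin_iff.2
    ⟨hA, by filter_upwards [hIoo] with ε hε using hApos ε hε⟩
  have hev : ∀ᶠ ε in 𝓝[>] (0 : ℝ), ∀ t ∈ Icc 0 T,
      essSupport (ω ε t) ⊆ Metric.ball (vorticityCenter (ω ε) t) (A ε ^ a) := by
    filter_upwards [hIoo, hA'.eventually hconf, hA.eventually (eventually_le_nhds one_pos),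
      hmass.abs.eventually (eventually_ge_nhds (by linarith : |Ω| / 2 < |Ω|)),
      hmass.abs.eventually (eventually_le_nhds (by linarith : |Ω| < 2 * |Ω|))]
      with ε hε hcε hA1 hm1 hm2 t ht
    have hA0 := hApos ε hε
    have h0 : totalVorticity (ω ε) ≠ 0 := abs_pos.1 (hm.trans_le hm1)
    have hint := (hω ε hε).integrable (zero_mem_lifespan hTstar)
    have htI : t ∈ Icc 0 T' := ⟨ht.1, ht.2.trans hT'T.le⟩
    have htl := Icc_subset_lifespan hT' htI
    have hflow := (hω ε hε).vortexFlow hTstar hD hnear hT'0 hT' (hF₂meas ε hε) (hF₁ ε hε)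
      (hF₂ ε hε) (by positivity) (hεA ε hε) (hsign ε hε) (hsupp ε hε) hm hm1 (by positivity)
      (hnorm ε hε) rfl
    have : IsProbabilityMeasure (labelMeasure (ω ε 0)) :=
      isProbabilityMeasure_labelMeasure hint h0 (hsign ε hε)
    have hc : |totalVorticity (ω ε) / (2 * Real.pi)| ≤ 2 * |Ω| := by
      have hpi : 1 ≤ 2 * Real.pi := by linarith [Real.pi_gt_three]
      rw [abs_div, abs_of_pos (by positivity : 0 < 2 * Real.pi)]
      exact (div_le_self (abs_nonneg _) hpi).trans hm2
    have hfin := hcε _ _ _ _ _ _ hflow hc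
    have hAb : 0 < A ε ^ b := by positivity
    rw [(hω ε hε).vorticityCenter_eq hTstar h0 (hsign ε hε) htl]
    refine ((hω ε hε).essSupport_subset_ball hTstar h0 htl (half_lt_self hAb) ?_).trans
      (Metric.ball_subset_ball
        (Real.rpow_le_rpow_of_exponent_ge hA0 hA1 (le_max_left a 0)))
    filter_upwards [hfin] with α hα using hα t htI
  obtain ⟨δ, hδ, hsub⟩ := mem_nhdsGT_iff_exists_Ioo_subset.1 hev
  have hδ0 : 0 < δ := hδ
  refine ⟨min δ ε₁ / 2, ⟨by positivity, ?_⟩, fun ε hε0 hε => hsub ⟨hε0, ?_⟩⟩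
  · linarith [min_le_right δ ε₁]
  · linarith [min_le_left δ ε₁]
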